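/- Let $0\le\tau<1$, $\rho(\tau)=\frac1{2(1-\tau)}$ and $s\ge 0$. On $L^2(\mathbb R)=L^2(\mathbb R;\mathbb C)$ let $H=-\partial_x^2+x^2$ be the (self-adjoint) harmonic oscillator, let $\tilde H=(H+1)^{\rho(\tau)}$, and let $\tilde{\mathbb H}^s=\{u\in L^2(\mathbb R):\tilde H^{s/2}u\in L^2(\mathbb R)\}$ with the norm $\|u\|_{\tilde{\mathbb H}^s}=\|\tilde H^{s/2}u\|_{L^2(\mathbb R)}$. Write $\langle y\rangle=(1+y^2)^{1/2}$. For $\epsilon>0$ consider the problem $$ i\partial_t u=-i\epsilon\,\partial_x u\quad\text{on }\mathbb R\times\mathbb R,\qquad u(0,\cdot)=u_0\in\tilde{\mathbb H}^s, $$ the equation being understood in the sense of distributions. (i) For every $\epsilon>0$ the problem is globally well-posed in $\tilde{\mathbb H}^s$: for every $u_0\in\tilde{\mathbb H}^s$ there is exactly one solution $u\in\mathcal C(\mathbb R;\tilde{\mathbb H}^s)$, it depends continuously on $u_0$ (uniformly on bounded time intervals), and it is given by $u(t,x)=u_0(x-\epsilon t)$. (ii) There is a constant $C>0$ depending only on $\tau$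 and $s$, and for every $u_0\in\tilde{\mathbb H}^s$ there is a constant $c>0$ depending only on $\tau$, $s$ and $u_0$, such that for all $\epsilon>0$ and all $t\in\mathbb R$ the solution satisfies $$ c\,\langle\epsilon t\rangle^{\frac{s}{2(1-\tau)}}\|u_0\|_{\tilde{\mathbb H}^s}\le\|u(t)\|_{\tilde{\mathbb H}^s}\le C\,\langle\epsilon t\rangle^{\frac{s}{2(1-\tau)}}\|u_0\|_{\tilde{\mathbb H}^s}. $$ -/

import Mathlib

open MeasureTheory Filter Topology
open scoped ENNReal ContDiff

noncomputable section

namespace HarmonicSobolev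

/-- The complex Hilbert space `L²(ℝ)`. -/
abbrev L2 : Type := Lp ℂ 2 (volume : Measure ℝ)

/-- The differential expression of the harmonic oscillator, `H f = -f'' + x² f`. -/
def harmonicOscillator (f : ℝ → ℝ) (x : ℝ) : ℝ :=
  -deriv (deriv f) x + x ^ 2 * f x

/-- The normalised Hermite functions
`h_n(x) = (n! √π)^{-1/2} He_n(√2 x) e^{-x²/2}`, with `He_n` the probabilists' Hermite
polynomials `Polynomial.hermite`. -/
def hermiteFn (n : ℕ) (x : ℝ) : ℝ :=
  (Real.sqrt (n.factorial * Real.sqrt Real.pi))⁻¹ *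
    Polynomial.aeval (Real.sqrt 2 * x) (Polynomial.hermite n) * Real.exp (-(x ^ 2) / 2)

/-- The real polynomial `He_n(√2 X)`. -/
def hermitePoly (n : ℕ) : Polynomial ℝ :=
  ((Polynomial.hermite n).map (Int.castRingHom ℝ)).comp
    (Polynomial.C (Real.sqrt 2) * Polynomial.X)

lemma hermitePoly_eval (n : ℕ) (x : ℝ) :
    (hermitePoly n).eval x = Polynomial.aeval (Real.sqrt 2 * x) (Polynomial.hermite n) := by
  simp [hermitePoly, Polynomial.eval_comp, Polynomial.aeval_def, Polynomial.eval_map]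

lemma hermitePoly_zero : hermitePoly 0 = 1 := by
  simp [hermitePoly]

lemma hermitePoly_succ (n : ℕ) :
    Polynomial.C (Real.sqrt 2) * hermitePoly (n + 1) =
      Polynomial.C 2 * Polynomial.X * hermitePoly n - Polynomial.derivative (hermitePoly n) := by
  have h2 : (Polynomial.C (Real.sqrt 2) : Polynomial ℝ) * Polynomial.C (Real.sqrt 2) =
      Polynomial.C 2 := by
    rw [← Polynomial.C_mul]; norm_num
  simp only [hermitePoly, Polynomial.hermite_succ, Polynomial.map_sub, Polynomial.map_mul,
    Polynomial.map_X, Polynomial.sub_comp, Polynomial.mul_comp, Polynomial.X_comp,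
    Polynomial.derivative_comp, Polynomial.derivative_map, Polynomial.derivative_mul,
    Polynomial.derivative_C, Polynomial.derivative_X]
  rw [← h2]
  ring

lemma hermitePoly_derivative (n : ℕ) :
    Polynomial.derivative (hermitePoly (n + 1)) =
      Polynomial.C (Real.sqrt 2) * (((n : ℝ) + 1) • hermitePoly n) := by
  have h2 : (Polynomial.C (Real.sqrt 2) : Polynomial ℝ) * Polynomial.C (Real.sqrt 2) =
      Polynomial.C 2 := by
    rw [← Polynomial.C_mul]; norm_num
  have hne : (Polynomial.C (Real.sqrt 2) : Polynomial ℝ) ≠ 0 := by simp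
  induction n with
  | zero =>
    apply mul_left_cancel₀ hne
    have := congrArg Polynomial.derivative (hermitePoly_succ 0)
    simp only [Polynomial.derivative_mul, Polynomial.derivative_C, hermitePoly_zero] at this
    simp only [Nat.cast_zero, zero_add, one_smul, hermitePoly_zero, ← mul_assoc, h2]
    simpa using this
  | succ n ih =>
    apply mul_left_cancel₀ hne
    have h := congrArg Polynomial.derivative (hermitePoly_succ (n + 1))
    have h1 := hermitePoly_succ n
    rw [Polynomial.derivative_mul, Polynomial.derivative_sub, ih, Polynomial.derivative_mul] at h
    simp only [Polynomial.derivative_mul, Polynomial.derivative_C, Polynomial.derivative_X, ih,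
      Polynomial.smul_eq_C_mul] at h ⊢
    simp only [zero_mul, zero_add, mul_one] at h
    rw [h]
    have e1 : Polynomial.C (((n + 1 : ℕ) : ℝ) + 1) = (Polynomial.C ((n : ℝ) + 1) + 1 : Polynomial ℝ) := by
      simp
    rw [e1]
    linear_combination (hermitePoly (n + 1)) * (-1) * h2 -
      Polynomial.C ((n : ℝ) + 1) * h1 * Polynomial.C (Real.sqrt 2)

lemma integrable_poly_mul_exp (p : Polynomial ℝ) {b : ℝ} (hb : 0 < b) :
    Integrable (fun x : ℝ => p.eval x * Real.exp (-b * x ^ 2)) := by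
  induction p using Polynomial.induction_on' with
  | add p q hp hq =>
    simp only [Polynomial.eval_add, add_mul]
    exact hp.add hq
  | monomial n a =>
    have := (integrable_rpow_mul_exp_neg_mul_sq hb (s := (n : ℝ))
      (by have : (0 : ℝ) ≤ n := n.cast_nonneg
          linarith)).const_mul a
    simpa [Real.rpow_natCast, mul_assoc] using this

lemma hasDerivAt_poly_mul_exp (p : Polynomial ℝ) (b x : ℝ) :
    HasDerivAt (fun x : ℝ => p.eval x * Real.exp (-b * x ^ 2))
      ((Polynomial.derivative p - Polynomial.C (2 * b) * Polynomial.X * p).eval x *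
        Real.exp (-b * x ^ 2)) x := by
  have h1 := p.hasDerivAt x
  have h2 : HasDerivAt (fun x : ℝ => Real.exp (-b * x ^ 2))
      (Real.exp (-b * x ^ 2) * (-b * (2 * x))) x := by
    have := (((hasDerivAt_id x).pow 2).const_mul (-b)).exp
    simpa using this
  convert! h1.mul h2 using 1
  simp only [Polynomial.eval_mul, Polynomial.eval_sub, Polynomial.eval_C, Polynomial.eval_X]
  ring

lemma hermiteFn_eq (n : ℕ) : hermiteFn n = fun x =>
    (Polynomial.C (Real.sqrt (n.factorial * Real.sqrt Real.pi))⁻¹ * hermitePoly n).eval x *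
      Real.exp (-(1 / 2) * x ^ 2) := by
  funext x
  simp only [hermiteFn, Polynomial.eval_mul, Polynomial.eval_C, hermitePoly_eval]
  congr 2
  ring

/-- The second order equation `P'' - 2 x P' + 2 n P = 0`. -/
lemma hermitePoly_ode (n : ℕ) :
    Polynomial.derivative (Polynomial.derivative (hermitePoly n)) =
      Polynomial.C 2 * Polynomial.X * Polynomial.derivative (hermitePoly n) -
        Polynomial.C (2 * (n : ℝ)) * hermitePoly n := by
  have h2 : (Polynomial.C (Real.sqrt 2) : Polynomial ℝ) * Polynomial.C (Real.sqrt 2) =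
      Polynomial.C 2 := by
    rw [← Polynomial.C_mul]; norm_num
  have h := congrArg Polynomial.derivative (hermitePoly_succ n)
  rw [Polynomial.derivative_mul, hermitePoly_derivative] at h
  simp only [Polynomial.derivative_mul, Polynomial.derivative_sub, Polynomial.derivative_C,
    Polynomial.derivative_X, zero_mul, zero_add, mul_one, Polynomial.smul_eq_C_mul,
    Polynomial.C_add, Polynomial.C_1] at h
  rw [Polynomial.C_mul]
  linear_combination h - (Polynomial.C (n : ℝ) + 1) * hermitePoly n * h2

/-- Hermite functions are eigenfunctions of the harmonic oscillator: `H h_n = (2n+1) h_n`. -/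
theorem harmonicOscillator_hermiteFn (n : ℕ) (x : ℝ) :
    harmonicOscillator (hermiteFn n) x = (2 * n + 1) * hermiteFn n x := by
  have key : ∀ p : Polynomial ℝ, deriv (fun x : ℝ => p.eval x * Real.exp (-(1 / 2) * x ^ 2)) =
      fun x => (Polynomial.derivative p - Polynomial.X * p).eval x *
        Real.exp (-(1 / 2) * x ^ 2) := by
    intro p
    funext y
    have := (hasDerivAt_poly_mul_exp p (1 / 2) y).deriv
    simpa using this
  rw [harmonicOscillator, hermiteFn_eq, key, key]
  have h := congrArg (Polynomial.eval x) (hermitePoly_ode n)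
  simp only [Polynomial.eval_mul, Polynomial.eval_sub, Polynomial.eval_C, Polynomial.eval_X,
    Polynomial.derivative_mul, Polynomial.derivative_sub, Polynomial.derivative_C,
    Polynomial.derivative_X, Polynomial.eval_add, zero_mul, zero_add, Polynomial.eval_one] at h ⊢
  rw [h]
  ring

lemma integral_hermitePoly_mul (n : ℕ) (q : Polynomial ℝ) :
    Real.sqrt 2 * ∫ x, (hermitePoly (n + 1) * q).eval x * Real.exp (-1 * x ^ 2) =
      ∫ x, (hermitePoly n * Polynomial.derivative q).eval x * Real.exp (-1 * x ^ 2) := by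
  have h0 := integral_eq_zero_of_hasDerivAt_of_integrable
    (fun x => hasDerivAt_poly_mul_exp (hermitePoly n * q) 1 x)
    (integrable_poly_mul_exp _ one_pos) (integrable_poly_mul_exp _ one_pos)
  rw [← integral_const_mul, ← sub_eq_zero, ← integral_sub
    ((integrable_poly_mul_exp _ one_pos).const_mul _) (integrable_poly_mul_exp _ one_pos),
    ← neg_eq_zero, ← integral_neg, ← h0]
  congr 1
  funext x
  have h := congrArg (Polynomial.eval x) (hermitePoly_succ n)
  simp only [Polynomial.eval_mul, Polynomial.eval_sub, Polynomial.eval_C, Polynomial.eval_X,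
    Polynomial.derivative_mul, Polynomial.eval_add] at h ⊢
  linear_combination (-1) * (q.eval x * Real.exp (-1 * x ^ 2)) * h

lemma integral_hermitePoly_sq (n m : ℕ) :
    ∫ x, (hermitePoly n * hermitePoly m).eval x * Real.exp (-1 * x ^ 2) =
      if n = m then n.factorial * Real.sqrt Real.pi else 0 := by
  have hs : Real.sqrt 2 ≠ 0 := by positivity
  induction n generalizing m with
  | zero =>
    cases m with
    | zero => 
      have := integral_gaussian 1
      simpa [hermitePoly_zero] using this
    | succ m =>
      apply mul_left_cancel₀ hs
      rw [mul_comm (hermitePoly 0), integral_hermitePoly_mul]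
      simp [hermitePoly_zero]
  | succ n ih =>
    apply mul_left_cancel₀ hs
    rw [integral_hermitePoly_mul]
    cases m with
    | zero => simp [hermitePoly_zero]
    | succ m =>
      rw [hermitePoly_derivative]
      have : ∀ x : ℝ, (hermitePoly n * (Polynomial.C (Real.sqrt 2) *
          (((m : ℝ) + 1) • hermitePoly m))).eval x * Real.exp (-1 * x ^ 2) =
          Real.sqrt 2 * ((m : ℝ) + 1) *
            ((hermitePoly n * hermitePoly m).eval x * Real.exp (-1 * x ^ 2)) := by
        intro x
        simp only [Polynomial.eval_mul, Polynomial.eval_C, Polynomial.eval_smul, smul_eq_mul]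
        ring
      simp only [this]
      rw [integral_const_mul, ih]
      by_cases hnm : n = m
      · subst hnm
        simp [Nat.factorial_succ]
        ring
      · simp [hnm]

lemma memLp_poly_mul_exp (p : Polynomial ℝ) {b : ℝ} (hb : 0 < b) :
    MemLp (fun x : ℝ => ((p.eval x * Real.exp (-b * x ^ 2) : ℝ) : ℂ)) 2 volume := by
  have hc : Continuous (fun x : ℝ => p.eval x * Real.exp (-b * x ^ 2)) :=
    p.continuous.mul (by fun_prop)
  have h : MemLp (fun x : ℝ => p.eval x * Real.exp (-b * x ^ 2)) 2 volume := by
    rw [memLp_two_iff_integrable_sq hc.aestronglyMeasurable]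
    have := integrable_poly_mul_exp (p * p) (b := 2 * b) (by positivity)
    convert! this using 2 with x
    rw [mul_pow, ← Real.exp_nat_mul]
    simp only [Polynomial.eval_mul]
    rw [sq]
    congr 2
    push_cast
    ring
  exact h.ofReal

lemma memLp_hermiteFn (n : ℕ) :
    MemLp (fun x : ℝ => ((hermiteFn n x : ℝ) : ℂ)) 2 volume := by
  rw [hermiteFn_eq]
  exact memLp_poly_mul_exp _ (by norm_num)

/-- The Hermite function `h_n` as an element of `L²(ℝ)`. -/
def hermiteL2 (n : ℕ) : L2 := (memLp_hermiteFn n).toLp _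

theorem orthonormal_hermiteL2 : Orthonormal ℂ hermiteL2 := by
  rw [orthonormal_iff_ite]
  intro n m
  rw [L2.inner_def]
  have h1 : ∫ x, inner ℂ (hermiteL2 n x) (hermiteL2 m x) =
      ∫ x, ((hermiteFn n x * hermiteFn m x : ℝ) : ℂ) := by
    apply integral_congr_ae
    filter_upwards [(memLp_hermiteFn n).coeFn_toLp, (memLp_hermiteFn m).coeFn_toLp] with x hx hy
    rw [hermiteL2, hermiteL2, hx, hy]
    simp [mul_comm]
  rw [h1]
  have h2 : ∀ x, hermiteFn n x * hermiteFn m x =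
      (Real.sqrt (n.factorial * Real.sqrt Real.pi))⁻¹ *
      (Real.sqrt (m.factorial * Real.sqrt Real.pi))⁻¹ *
      ((hermitePoly n * hermitePoly m).eval x * Real.exp (-1 * x ^ 2)) := by
    intro x
    have : Real.exp (-1 * x ^ 2) = Real.exp (-(1 / 2) * x ^ 2) * Real.exp (-(1 / 2) * x ^ 2) := by
      rw [← Real.exp_add]; congr 1; ring
    rw [this, hermiteFn_eq, hermiteFn_eq]
    simp only [Polynomial.eval_mul, Polynomial.eval_C]
    ring
  simp only [h2]
  rw [integral_complex_ofReal, integral_const_mul, integral_hermitePoly_sq]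
  by_cases hnm : n = m
  · subst hnm
    have hpos : (0 : ℝ) < n.factorial * Real.sqrt Real.pi := by positivity
    simp only [if_true]
    rw [← mul_inv, Real.mul_self_sqrt hpos.le, inv_mul_cancel₀ hpos.ne']
    simp
  · simp [hnm]

/-- An integrable function with vanishing Fourier transform vanishes almost everywhere. -/
lemma ae_eq_zero_of_fourier_eq_zero {f : ℝ → ℂ} (hf : Integrable f)
    (h : ∀ ξ : ℝ, FourierTransform.fourier f ξ = 0) : ∀ᵐ x, f x = 0 := by
  apply ae_eq_zero_of_integral_contDiff_smul_eq_zero hf.locallyIntegrable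
  intro g hg hgs
  have hg1 : ContDiff ℝ ∞ (fun x => (g x : ℂ)) := Complex.ofRealCLM.contDiff.comp hg
  have hg2 : HasCompactSupport (fun x => (g x : ℂ)) :=
    hgs.comp_left (g := fun y : ℝ => (y : ℂ)) Complex.ofReal_zero
  set G : SchwartzMap ℝ ℂ := hg2.toSchwartzMap hg1
  set K : SchwartzMap ℝ ℂ := FourierTransformInv.fourierInv G
  have hK : FourierTransform.fourier K = G := FourierTransform.fourier_fourierInv_eq G
  have h1 := VectorFourier.integral_fourierIntegral_smul_eq_flip (L := innerₗ ℝ)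
    Real.continuous_fourierChar continuous_inner (K.integrable (μ := volume)) hf
  have h2 : ∀ x, (g x) • f x = (FourierTransform.fourier (K : ℝ → ℂ) x) • f x := by
    intro x
    have : FourierTransform.fourier (K : ℝ → ℂ) x = G x := by
      rw [← hK]; rfl
    rw [this]
    simp [G]
  simp only [h2]
  refine h1.trans ?_
  have h3 : ∀ x, VectorFourier.fourierIntegral Real.fourierChar volume
      (innerₗ ℝ).flip f x = 0 := by
    intro x
    rw [flip_innerₗ]
    exact h x
  simp only [h3, smul_zero, integral_zero]

lemma ae_eq_zero_of_moments_eq_zero {f : ℝ → ℂ} (hf : MemLp f 2 volume)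
    (h : ∀ k : ℕ, ∫ x, ((x ^ k * Real.exp (-(1 / 2) * x ^ 2) : ℝ) : ℂ) * f x = 0) :
    ∀ᵐ x, f x = 0 := by
  have hfm : AEStronglyMeasurable f volume := hf.aestronglyMeasurable
  have hint : Integrable (fun x => ((Real.exp (-(1 / 2) * x ^ 2) : ℝ) : ℂ) * f x) := by
    have := (memLp_poly_mul_exp 1 (b := 1 / 2) (by norm_num)).integrable_mul hf
    simpa using! this
  have key : ∀ᵐ x, ((Real.exp (-(1 / 2) * x ^ 2) : ℝ) : ℂ) * f x = 0 := by
    apply ae_eq_zero_of_fourier_eq_zero hint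
    intro ξ
    rw [Real.fourier_real_eq_integral_exp_smul]
    set c : ℂ := ((-2 * Real.pi * ξ : ℝ) : ℂ) * Complex.I with hc
    set a : ℝ := ‖c‖ with ha
    have hs := hasSum_integral_of_dominated_convergence (μ := volume)
      (F := fun (k : ℕ) (x : ℝ) => (c ^ k / (k.factorial : ℂ)) *
        (((x ^ k * Real.exp (-(1 / 2) * x ^ 2) : ℝ) : ℂ) * f x))
      (f := fun x : ℝ => Complex.exp (c * x) *
        (((Real.exp (-(1 / 2) * x ^ 2) : ℝ) : ℂ) * f x))
      (fun (k : ℕ) (x : ℝ) => (a * |x|) ^ k / (k.factorial : ℝ) *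
        (Real.exp (-(1 / 2) * x ^ 2) * ‖f x‖))
      ?_ ?_ ?_ ?_ ?_
    · simp only [integral_const_mul, h, mul_zero] at hs
      rw [← hs.unique hasSum_zero]
      congr 1
      funext x
      rw [smul_eq_mul, hc]
      congr 2
      push_cast
      ring
    · intro k
      apply AEStronglyMeasurable.const_mul
      refine AEStronglyMeasurable.mul (Continuous.aestronglyMeasurable ?_) hfm
      fun_prop
    · intro k
      refine Eventually.of_forall fun x => le_of_eq ?_
      simp only [norm_mul, norm_div, norm_pow, Complex.norm_real, Real.norm_eq_abs, Real.abs_exp,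
        Complex.norm_natCast]
      rw [mul_pow]
      ring
    · refine Eventually.of_forall fun x => ?_
      exact (Real.summable_pow_div_factorial (a * |x|)).mul_right _
    · have hb := ((memLp_poly_mul_exp 1 (b := 1 / 4) (by norm_num)).norm.integrable_mul
        hf.norm).const_mul (Real.exp (a ^ 2))
      refine hb.mono' ?_ ?_
      · apply AEStronglyMeasurable.congr (f := fun x : ℝ =>
          Real.exp (a * |x|) * (Real.exp (-(1 / 2) * x ^ 2) * ‖f x‖))
        · refine AEStronglyMeasurable.mul (Continuous.aestronglyMeasurable (by fun_prop))
            (AEStronglyMeasurable.mul (Continuous.aestronglyMeasurable (by fun_prop)) hfm.norm)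
        · refine Eventually.of_forall fun x => ?_
          simp only
          rw [tsum_mul_right, Real.exp_eq_exp_ℝ, NormedSpace.exp_eq_tsum_div]
      · refine Eventually.of_forall fun x => ?_
        rw [tsum_mul_right]
        have he : ∑' n : ℕ, (a * |x|) ^ n / (n.factorial : ℝ) = Real.exp (a * |x|) := by
          rw [Real.exp_eq_exp_ℝ, NormedSpace.exp_eq_tsum_div]
        rw [he, Real.norm_of_nonneg (by positivity), ← mul_assoc, ← Real.exp_add]
        simp only [Pi.mul_apply, Polynomial.eval_one, one_mul, Complex.norm_real,
          Real.norm_eq_abs, Real.abs_exp]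
        rw [← mul_assoc, ← Real.exp_add]
        apply mul_le_mul_of_nonneg_right _ (norm_nonneg _)
        apply Real.exp_le_exp.mpr
        have := sq_nonneg (|x| - 2 * a)
        nlinarith [sq_abs x]
    · refine Eventually.of_forall fun x => ?_
      have he : HasSum (fun k : ℕ => (c * x) ^ k / (k.factorial : ℂ)) (Complex.exp (c * x)) := by
        rw [Complex.exp_eq_exp_ℂ]
        exact NormedSpace.expSeries_div_hasSum_exp (c * x)
      have := he.mul_right (((Real.exp (-(1 / 2) * x ^ 2) : ℝ) : ℂ) * f x)
      convert! this using 1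
      funext k
      push_cast
      rw [mul_pow]
      ring
  filter_upwards [key] with x hx
  have : ((Real.exp (-(1 / 2) * x ^ 2) : ℝ) : ℂ) ≠ 0 := by
    exact_mod_cast (Real.exp_pos _).ne'
  exact (mul_eq_zero.mp hx).resolve_left this

theorem span_hermiteL2_orthogonal :
    (Submodule.span ℂ (Set.range hermiteL2))ᗮ = ⊥ := by
  rw [Submodule.eq_bot_iff]
  intro f hf
  have hfm : MemLp (f : ℝ → ℂ) 2 volume := Lp.memLp f
  have hint : ∀ p : Polynomial ℝ, Integrable
      (fun x => ((p.eval x * Real.exp (-(1 / 2) * x ^ 2) : ℝ) : ℂ) * f x) := fun p =>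
    (memLp_poly_mul_exp p (b := 1 / 2) (by norm_num)).integrable_mul hfm
  let M : Polynomial ℝ →ₗ[ℝ] ℂ :=
    { toFun := fun p => ∫ x, ((p.eval x * Real.exp (-(1 / 2) * x ^ 2) : ℝ) : ℂ) * f x
      map_add' := by
        intro p q
        rw [← integral_add (hint p) (hint q)]
        congr 1
        funext x
        rw [Polynomial.eval_add]
        push_cast
        ring
      map_smul' := by
        intro r p
        rw [RingHom.id_apply, Complex.real_smul, ← integral_const_mul]
        congr 1
        funext x
        rw [Polynomial.eval_smul, smul_eq_mul]
        push_cast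
        ring }
  have hM : ∀ n, M (hermitePoly n) = 0 := by
    intro n
    have h0 : inner ℂ (hermiteL2 n) f = 0 :=
      (Submodule.mem_orthogonal _ f).mp hf _ (Submodule.subset_span ⟨n, rfl⟩)
    rw [L2.inner_def] at h0
    have h1 : ∫ x, inner ℂ (hermiteL2 n x) (f x) =
        M (Polynomial.C (Real.sqrt (n.factorial * Real.sqrt Real.pi))⁻¹ * hermitePoly n) := by
      apply integral_congr_ae
      filter_upwards [(memLp_hermiteFn n).coeFn_toLp] with x hx
      rw [hermiteL2, hx, hermiteFn_eq]
      simp only [RCLike.inner_apply, Complex.conj_ofReal]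
      rw [mul_comm]
    rw [h1, ← Polynomial.smul_eq_C_mul, map_smul] at h0
    have hpos : (Real.sqrt (n.factorial * Real.sqrt Real.pi))⁻¹ ≠ 0 := by positivity
    exact (smul_eq_zero.mp h0).resolve_left hpos
  have hX : ∀ k n, M (Polynomial.X ^ k * hermitePoly n) = 0 := by
    intro k
    induction k with
    | zero => simpa using hM
    | succ k ih =>
      intro n
      have e1 : (2 : ℝ) • (Polynomial.X ^ (k + 1) * hermitePoly n) =
          Real.sqrt 2 • (Polynomial.X ^ k * hermitePoly (n + 1)) +
            Polynomial.X ^ k * Polynomial.derivative (hermitePoly n) := by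
        simp only [Polynomial.smul_eq_C_mul]
        linear_combination (-1) * Polynomial.X ^ k * hermitePoly_succ n
      have e2 : M (Polynomial.X ^ k * Polynomial.derivative (hermitePoly n)) = 0 := by
        cases n with
        | zero => simp [hermitePoly_zero]
        | succ n =>
          have : Polynomial.X ^ k * Polynomial.derivative (hermitePoly (n + 1)) =
              (Real.sqrt 2 * ((n : ℝ) + 1)) • (Polynomial.X ^ k * hermitePoly n) := by
            rw [hermitePoly_derivative]
            simp only [Polynomial.smul_eq_C_mul, Polynomial.C_mul]
            ring
          rw [this, map_smul, ih, smul_zero]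
      have e3 := congrArg M e1
      rw [map_smul, map_add, map_smul, ih, e2, smul_zero, zero_add] at e3
      exact (smul_eq_zero.mp e3).resolve_left two_ne_zero
  have hz := ae_eq_zero_of_moments_eq_zero hfm (fun k => by
    have := hX k 0
    simpa [M, hermitePoly_zero] using! this)
  exact (Lp.eq_zero_iff_ae_eq_zero).mpr hz

/-- The Hilbert basis of `L²(ℝ)` given by the Hermite functions. -/
def hermiteBasis : HilbertBasis ℕ ℂ L2 :=
  HilbertBasis.mkOfOrthogonalEqBot orthonormal_hermiteL2 span_hermiteL2_orthogonal

/-- The operator `F(H)` of the functional calculus of the self-adjoint operator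
`H = -∂ₓ² + x²` on `L²(ℝ)`, which is diagonal in the Hermite basis with `H h_n = (2n+1) h_n`:
its domain is `{u : ∑ |F(2n+1)|² |⟨h_n, u⟩|² < ∞}` and
`F(H) u = ∑ F(2n+1) ⟨h_n, u⟩ h_n`. -/
def oscillatorCalculus (F : ℝ → ℝ) : L2 →ₗ.[ℂ] L2 where
  domain :=
    { carrier := {u | Memℓp (fun n : ℕ => (F (2 * n + 1) : ℂ) * inner ℂ (hermiteBasis n) u) 2}
      add_mem' := by
        intro u v hu hv
        have := Memℓp.add hu hv
        simpa only [Set.mem_ofPred_eq, inner_add_right, mul_add] using! this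
      zero_mem' := by
        simpa only [Set.mem_ofPred_eq, inner_zero_right, mul_zero] using!
          (zero_memℓp : Memℓp (0 : ℕ → ℂ) 2)
      smul_mem' := by
        intro c u hu
        have := Memℓp.const_smul hu c
        simpa only [Set.mem_ofPred_eq, inner_smul_right, mul_left_comm] using! this }
  toFun :=
    { toFun := fun u => hermiteBasis.repr.symm
        ⟨fun n : ℕ => (F (2 * n + 1) : ℂ) * inner ℂ (hermiteBasis n) (u : L2), u.2⟩
      map_add' := by
        intro u v
        rw [← map_add]
        congr 1
        ext n
        simp only [Submodule.coe_add, inner_add_right, mul_add, lp.coeFn_add, Pi.add_apply]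
      map_smul' := by
        intro c u
        rw [RingHom.id_apply, ← map_smul]
        congr 1
        ext n
        simp [inner_smul_right, mul_left_comm] }

lemma inner_oscillatorCalculus (F : ℝ → ℝ) (u : (oscillatorCalculus F).domain) (n : ℕ) :
    inner ℂ (hermiteBasis n) (oscillatorCalculus F u) =
      (F (2 * n + 1) : ℂ) * inner ℂ (hermiteBasis n) (u : L2) := by
  rw [← HilbertBasis.repr_apply_apply]
  change hermiteBasis.repr (hermiteBasis.repr.symm _) n = _
  rw [LinearIsometryEquiv.apply_symm_apply]

/-- The exponent `ρ(τ) = 1 / (2 (1 - τ))`. -/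
def rho (τ : ℝ) : ℝ := 1 / (2 * (1 - τ))

/-- The power `H̃^α` of the operator `H̃ = (H + 1)^{ρ(τ)}`, as an unbounded operator
on `L²(ℝ)`; `H̃` itself is the case `α = 1`. -/
def HtildePow (τ α : ℝ) : L2 →ₗ.[ℂ] L2 :=
  oscillatorCalculus fun l => ((l + 1) ^ rho τ) ^ α

lemma HtildePow_injective (τ α : ℝ) : Function.Injective (HtildePow τ α).toFun := by
  rw [injective_iff_map_eq_zero]
  intro u hu
  have h0 : (u : L2) = 0 := by
    apply hermiteBasis.repr.injective
    ext n
    rw [map_zero, HilbertBasis.repr_apply_apply]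
    have h := inner_oscillatorCalculus (fun l => ((l + 1) ^ rho τ) ^ α) u n
    have hu' : oscillatorCalculus (fun l => ((l + 1) ^ rho τ) ^ α) u = 0 := hu
    rw [hu', inner_zero_right] at h
    have hpos : (0 : ℝ) < (((2 * (n : ℝ) + 1) + 1) ^ rho τ) ^ α := by positivity
    exact (mul_eq_zero.mp h.symm).resolve_left (by exact_mod_cast hpos.ne')
  exact Subtype.ext h0

/-- The space `ℍ̃^s = {u ∈ L²(ℝ) : H̃^{s/2} u ∈ L²(ℝ)}`, the domain of `H̃^{s/2}`. It is a
separate type, so that it carries only the norm `‖H̃^{s/2} u‖_{L²}` given below, and not the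
norm of `L²`. -/
def HSpace (τ s : ℝ) : Type := (HtildePow τ (s / 2)).domain

namespace HSpace

instance (τ s : ℝ) : AddCommGroup (HSpace τ s) :=
  inferInstanceAs (AddCommGroup (HtildePow τ (s / 2)).domain)

instance (τ s : ℝ) : Module ℂ (HSpace τ s) :=
  inferInstanceAs (Module ℂ (HtildePow τ (s / 2)).domain)

/-- The inclusion of `ℍ̃^s` in `L²(ℝ)`. -/
def toL2 {τ s : ℝ} : HSpace τ s →ₗ[ℂ] L2 := (HtildePow τ (s / 2)).domain.subtype

/-- The map `u ↦ H̃^{s/2} u` from `ℍ̃^s` to `L²(ℝ)`. -/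
def halfPow {τ s : ℝ} : HSpace τ s →ₗ[ℂ] L2 := (HtildePow τ (s / 2)).toFun

/-- The norm of `ℍ̃^s` is `‖u‖ = ‖H̃^{s/2} u‖_{L²}`. -/
instance (τ s : ℝ) : NormedAddCommGroup (HSpace τ s) :=
  NormedAddCommGroup.induced (HSpace τ s) L2 halfPow (HtildePow_injective τ (s / 2))

instance (τ s : ℝ) : NormedSpace ℂ (HSpace τ s) :=
  NormedSpace.induced ℂ (HSpace τ s) L2 halfPow

lemma norm_def {τ s : ℝ} (u : HSpace τ s) : ‖u‖ = ‖halfPow u‖ := rfl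

end HSpace

/-- `u ∈ C(ℝ; ℍ̃^s)` is a solution of `i ∂ₜ u = -i ε ∂ₓ u`, `u(0) = u₀`, the equation being
understood in the sense of distributions on `ℝ × ℝ`. -/
structure IsTransportSolution {τ s : ℝ} (ε : ℝ) (u₀ : HSpace τ s) (u : ℝ → HSpace τ s) :
    Prop where
  continuous : Continuous u
  initial : u 0 = u₀
  equation : ∀ φ : ℝ × ℝ → ℂ, ContDiff ℝ ∞ φ → HasCompactSupport φ →
    Complex.I * (-∫ t : ℝ, ∫ x : ℝ, (u t).toL2 x * fderiv ℝ φ (t, x) (1, 0)) =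
      -(Complex.I * ε) * (-∫ t : ℝ, ∫ x : ℝ, (u t).toL2 x * fderiv ℝ φ (t, x) (0, 1))

/-- Global well-posedness of the transport problem in `ℍ̃^s`: every initial datum in `ℍ̃^s` has
exactly one solution in `C(ℝ; ℍ̃^s)`, and the solution depends continuously on the datum,
uniformly on bounded time intervals. -/
def TransportGloballyWellPosed (τ s ε : ℝ) : Prop :=
  (∀ u₀ : HSpace τ s, ∃! u : ℝ → HSpace τ s, IsTransportSolution ε u₀ u) ∧
  ∀ u₀ : HSpace τ s, ∀ T > 0, ∀ η > 0, ∃ δ > 0, ∀ (v₀ : HSpace τ s) (u v : ℝ → HSpace τ s),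
    IsTransportSolution ε u₀ u → IsTransportSolution ε v₀ v → ‖v₀ - u₀‖ < δ →
      ∀ t ∈ Set.Icc (-T) T, ‖v t - u t‖ < η

/-- The bracket `⟨y⟩ = (1 + y²)^{1/2}`. -/
def japaneseBracket (y : ℝ) : ℝ := Real.sqrt (1 + y ^ 2)

end HarmonicSobolev

end

namespace HarmonicSobolev

/-! ### Weighted energies of Hermite coefficient systems -/

/-! Put r = s/(2(1-τ)). In Hermite coefficients the squared norm of ℍ̃^s is the sum of (2n+2)^r
|c_n|², and a solution is the translate of its datum by a = εt, so everything reduces to how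
translation moves mass between Hermite modes. The coefficients c_n(a) of u(· - a) satisfy c_n' =
√(n/2) c_{n-1} - √((n+1)/2) c_{n+1}, a skew-symmetric tridiagonal system. A weighted energy Σ w_n
|c_n|² therefore changes only through the increments w_{n+1} - w_n, and if these are at most K
w_n/√(n+1), Grönwall's inequality bounds its growth by e^{2K|a|} (`weighted_tsum_le`).

Upper bound: the weight (2n+2+B)^r admits K of order 1/√(1+B) (`powerWeight_succ_sub_le`). With B =
a² the product K|a| stays bounded, and this weight lies between (2n+2)^r and (1+a²)^r (2n+2)^r; that
comparison alone produces the factor ⟨a⟩^r (`norm_translate_le`).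

Lower bound: the recurrence for x h_n shows that a far translate has little mass in the modes below
δa² (`exists_low_modes_bound`). A fixed fraction of the L² mass thus carries weight of order at
least ⟨a⟩^{2r} (`exists_le_norm_translate`).

Well-posedness: integration along the characteristics shows that translates solve the equation
(`isWeakTransport_translate`) and that no other L²-continuous solution exists
(`IsWeakTransport.eq_translate`). Strong continuity in ℍ̃^s follows from convergence of coefficients
together with convergence of norms. -/

lemma sum_telescope_weight (w E : ℕ → ℝ) (hE : E 0 = 0) (N : ℕ) :
    ∑ n ∈ Finset.range N, (w N - w n) * (E n - E (n + 1)) =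
      -∑ n ∈ Finset.range N, (w (n + 1) - w n) * E (n + 1) := by
  induction N with
  | zero => simp
  | succ N ih =>
    have h1 : ∑ n ∈ Finset.range N, (w (N + 1) - w n) * (E n - E (n + 1)) =
        ∑ n ∈ Finset.range N, (w N - w n) * (E n - E (n + 1)) +
          (w (N + 1) - w N) * ∑ n ∈ Finset.range N, (E n - E (n + 1)) := by
      rw [Finset.mul_sum, ← Finset.sum_add_distrib]
      exact Finset.sum_congr rfl fun n _ => by ring
    rw [Finset.sum_range_succ, h1, ih, Finset.sum_range_sub', hE, Finset.sum_range_succ]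
    ring

/-- The coefficients satisfy the system that translation induces on Hermite coefficients, and
their square sum is the constant `M`. -/
structure IsTranslationSystem (c : ℕ → ℝ → ℂ) (M : ℝ) : Prop where
  hasDerivAt : ∀ n a, HasDerivAt (c n)
    (Real.sqrt (n / 2) • c (n - 1) a - Real.sqrt ((n + 1) / 2) • c (n + 1) a) a
  hasSum : ∀ a, HasSum (fun n => ‖c n a‖ ^ 2) M

/-- The energy with the weight `w` frozen beyond the index `N`. -/
noncomputable def truncatedEnergy (w : ℕ → ℝ) (c : ℕ → ℝ → ℂ) (M : ℝ) (N : ℕ) (a : ℝ) : ℝ :=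
  w N * M - ∑ n ∈ Finset.range N, (w N - w n) * ‖c n a‖ ^ 2

namespace IsTranslationSystem

variable {c : ℕ → ℝ → ℂ} {M : ℝ} {w : ℕ → ℝ} {K : ℝ}

/-- Because the total mass M is conserved, freezing the weight leaves only a finite sum to
differentiate. Mass moves between neighbouring modes by a flux E, and summation by parts turns
differences of fluxes into increments of the weight. -/
lemma hasDerivAt_truncatedEnergy (hc : IsTranslationSystem c M) (w : ℕ → ℝ) (N : ℕ) (a : ℝ) :
    HasDerivAt (truncatedEnergy w c M N)
      (∑ n ∈ Finset.range N, (w (n + 1) - w n) *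
        (2 * Real.sqrt ((n + 1) / 2) * inner ℝ (c (n + 1) a) (c n a))) a := by
  -- E n is the flux from mode n - 1 into mode n. The truncated subtraction at n = 0 is harmless,
  -- since the factor √(0/2) gives E 0 = 0.
  set E : ℕ → ℝ := fun n => 2 * Real.sqrt (n / 2) * inner ℝ (c n a) (c (n - 1) a) with hE
  have h1 : ∀ n, HasDerivAt (fun a => ‖c n a‖ ^ 2) (E n - E (n + 1)) a := by
    intro n
    convert! (hc.hasDerivAt n a).norm_sq using 1
    simp only [hE, inner_sub_right, real_inner_smul_right, Nat.add_sub_cancel]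
    rw [real_inner_comm (c n a) (c (n + 1) a)]
    push_cast
    ring
  have h2 := (HasDerivAt.fun_sum fun n (_ : n ∈ Finset.range N) =>
    (h1 n).const_mul (w N - w n)).const_sub (w N * M)
  convert! h2 using 1
  rw [sum_telescope_weight w E (by simp [hE]), neg_neg]
  simp [hE]

lemma sum_le (hc : IsTranslationSystem c M) (N : ℕ) (a : ℝ) :
    ∑ n ∈ Finset.range N, ‖c n a‖ ^ 2 ≤ M :=
  sum_le_hasSum _ (fun _ _ => by positivity) (hc.hasSum a)

lemma truncatedEnergy_eq (w : ℕ → ℝ) (N : ℕ) (a : ℝ) :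
    truncatedEnergy w c M N a = ∑ n ∈ Finset.range N, w n * ‖c n a‖ ^ 2 +
      w N * (M - ∑ n ∈ Finset.range N, ‖c n a‖ ^ 2) := by
  simp only [truncatedEnergy, sub_mul, Finset.sum_sub_distrib, ← Finset.mul_sum]
  ring

/-- The mass outside the first N modes contains that of mode N. Including this extra mode matters:
the derivative of the truncated energy couples mode N - 1 to mode N. -/
lemma sum_le_truncatedEnergy (hc : IsTranslationSystem c M) (hw : ∀ n, 0 ≤ w n) (N : ℕ) (a : ℝ) :
    ∑ n ∈ Finset.range (N + 1), w n * ‖c n a‖ ^ 2 ≤ truncatedEnergy w c M N a := by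
  have h := hc.sum_le (N + 1) a
  rw [Finset.sum_range_succ] at h
  rw [truncatedEnergy_eq, Finset.sum_range_succ]
  gcongr
  · exact hw N
  · linarith

lemma truncatedEnergy_le_tsum (hc : IsTranslationSystem c M) (hw : Monotone w)
    (N : ℕ) (a : ℝ) (hs : Summable fun n => w n * ‖c n a‖ ^ 2) :
    truncatedEnergy w c M N a ≤ ∑' n, w n * ‖c n a‖ ^ 2 := by
  rw [truncatedEnergy_eq, ← hs.sum_add_tsum_nat_add N, ← (hc.hasSum a).tsum_eq,
    ← (hc.hasSum a).summable.sum_add_tsum_nat_add N, add_sub_cancel_left, ← tsum_mul_left]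
  refine add_le_add le_rfl (Summable.tsum_le_tsum (fun n => ?_)
    (((summable_nat_add_iff N).2 (hc.hasSum a).summable).mul_left _)
    ((summable_nat_add_iff N).2 hs))
  gcongr
  exact hw (by omega)

/-- The condition on the increments absorbs the factor √(n+1), and 2|xy| ≤ |x|² + |y|² splits each
coupling into two diagonal terms. Both resulting sums, the plain and the shifted one, are bounded by
the truncated energy. -/
lemma abs_deriv_truncatedEnergy_le (hc : IsTranslationSystem c M) (hw : Monotone w)
    (hw0 : ∀ n, 0 ≤ w n) (hK : 0 ≤ K)
    (hwK : ∀ n, (w (n + 1) - w n) * Real.sqrt (n + 1) ≤ K * w n) (N : ℕ) (a : ℝ) :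
    |∑ n ∈ Finset.range N, (w (n + 1) - w n) *
        (2 * Real.sqrt ((n + 1) / 2) * inner ℝ (c (n + 1) a) (c n a))| ≤
      2 * K * truncatedEnergy w c M N a := by
  have h1 : ∀ n, |(w (n + 1) - w n) *
        (2 * Real.sqrt ((n + 1) / 2) * inner ℝ (c (n + 1) a) (c n a))| ≤
      K * (w n * ‖c n a‖ ^ 2 + w (n + 1) * ‖c (n + 1) a‖ ^ 2) := by
    intro n
    have hd : 0 ≤ w (n + 1) - w n := sub_nonneg.2 (hw n.le_succ)
    have hin := abs_real_inner_le_norm (c (n + 1) a) (c n a)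
    have hsq : Real.sqrt ((n + 1) / 2) ≤ Real.sqrt (n + 1) :=
      Real.sqrt_le_sqrt (by linarith [n.cast_nonneg (α := ℝ)])
    rw [abs_mul, abs_mul, abs_of_nonneg hd, abs_of_nonneg (by positivity :
      (0 : ℝ) ≤ 2 * Real.sqrt ((n + 1) / 2))]
    calc (w (n + 1) - w n) * (2 * Real.sqrt ((n + 1) / 2) * |inner ℝ (c (n + 1) a) (c n a)|)
        ≤ (w (n + 1) - w n) * (2 * Real.sqrt (n + 1) * (‖c (n + 1) a‖ * ‖c n a‖)) := by gcongr
      _ = ((w (n + 1) - w n) * Real.sqrt (n + 1)) * (2 * ‖c (n + 1) a‖ * ‖c n a‖) := by ring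
      _ ≤ (K * w n) * (‖c n a‖ ^ 2 + ‖c (n + 1) a‖ ^ 2) := by
          refine mul_le_mul (hwK n) ?_ (by positivity) (mul_nonneg hK (hw0 n))
          nlinarith [sq_nonneg (‖c (n + 1) a‖ - ‖c n a‖)]
      _ = K * (w n * ‖c n a‖ ^ 2 + w n * ‖c (n + 1) a‖ ^ 2) := by ring
      _ ≤ _ := by
          gcongr
          exact hw n.le_succ
  calc _ ≤ ∑ n ∈ Finset.range N, K * (w n * ‖c n a‖ ^ 2 + w (n + 1) * ‖c (n + 1) a‖ ^ 2) :=
        (Finset.abs_sum_le_sum_abs _ _).trans (Finset.sum_le_sum fun n _ => h1 n)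
    _ = K * (∑ n ∈ Finset.range N, w n * ‖c n a‖ ^ 2 +
          ∑ n ∈ Finset.range N, w (n + 1) * ‖c (n + 1) a‖ ^ 2) := by
        rw [← Finset.sum_add_distrib, Finset.mul_sum]
    _ ≤ K * (truncatedEnergy w c M N a + truncatedEnergy w c M N a) := by
        have h := hc.sum_le_truncatedEnergy hw0 N a
        have h2 := h
        rw [Finset.sum_range_succ] at h
        rw [Finset.sum_range_succ'] at h2
        have p1 := mul_nonneg (hw0 N) (sq_nonneg ‖c N a‖)
        have p2 := mul_nonneg (hw0 0) (sq_nonneg ‖c 0 a‖)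
        gcongr <;> linarith
    _ = _ := by ring

/-- Grönwall's inequality by an integrating factor. The derivative bound is two-sided, so the
estimate runs in both directions of translation. -/
lemma truncatedEnergy_le_exp_mul (hc : IsTranslationSystem c M) (hw : Monotone w)
    (hw0 : ∀ n, 0 ≤ w n) (hK : 0 ≤ K)
    (hwK : ∀ n, (w (n + 1) - w n) * Real.sqrt (n + 1) ≤ K * w n) (N : ℕ) (a b : ℝ) :
    truncatedEnergy w c M N a ≤ Real.exp (2 * K * |a - b|) * truncatedEnergy w c M N b := by
  set Y := truncatedEnergy w c M N
  have hd := fun x => hc.hasDerivAt_truncatedEnergy w N x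
  have hb := fun x => abs_le.1 (hc.abs_deriv_truncatedEnergy_le hw hw0 hK hwK N x)
  have hexp : ∀ k x : ℝ, HasDerivAt (fun x => Real.exp (k * x)) (Real.exp (k * x) * k) x := by
    intro k x
    simpa using ((hasDerivAt_id x).const_mul k).exp
  rcases le_total b a with h | h
  · have hanti : Antitone fun x => Real.exp (-(2 * K) * x) * Y x := by
      refine antitone_of_hasDerivAt_nonpos (fun x => (hexp _ x).mul (hd x)) fun x => ?_
      have := mul_nonneg (Real.exp_pos (-(2 * K) * x)).le (sub_nonneg.2 (hb x).2)
      simp only [Pi.zero_apply]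
      linarith
    have h1 := hanti h
    rw [abs_of_nonneg (sub_nonneg.2 h), show 2 * K * (a - b) = 2 * K * a + -(2 * K) * b by ring,
      Real.exp_add, mul_assoc]
    calc Y a = Real.exp (2 * K * a) * (Real.exp (-(2 * K) * a) * Y a) := by
          rw [← mul_assoc, ← Real.exp_add]; simp
      _ ≤ _ := by gcongr
  · have hmono : Monotone fun x => Real.exp ((2 * K) * x) * Y x := by
      refine monotone_of_hasDerivAt_nonneg (fun x => (hexp _ x).mul (hd x)) fun x => ?_
      have := mul_nonneg (Real.exp_pos ((2 * K) * x)).le (sub_nonneg.2 (hb x).1)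
      simp only [Pi.zero_apply]
      linarith
    have h1 := hmono h
    rw [abs_of_nonpos (sub_nonpos.2 h), show 2 * K * -(a - b) = -(2 * K) * a + (2 * K) * b by ring,
      Real.exp_add, mul_assoc]
    calc Y a = Real.exp (-(2 * K) * a) * (Real.exp (2 * K * a) * Y a) := by
          rw [← mul_assoc, ← Real.exp_add]; simp
      _ ≤ _ := by gcongr

/-- The truncated bounds do not depend on N, so finiteness of the energy at b yields finiteness at
a. This is what makes the weighted space invariant under translation. -/
theorem weighted_tsum_le (hc : IsTranslationSystem c M) (hw : Monotone w)
    (hw0 : ∀ n, 0 ≤ w n) (hK : 0 ≤ K)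
    (hwK : ∀ n, (w (n + 1) - w n) * Real.sqrt (n + 1) ≤ K * w n) (a b : ℝ)
    (hs : Summable fun n => w n * ‖c n b‖ ^ 2) :
    (Summable fun n => w n * ‖c n a‖ ^ 2) ∧
      ∑' n, w n * ‖c n a‖ ^ 2 ≤ Real.exp (2 * K * |a - b|) * ∑' n, w n * ‖c n b‖ ^ 2 := by
  have h0 : ∀ n, 0 ≤ w n * ‖c n a‖ ^ 2 := fun n => mul_nonneg (hw0 n) (sq_nonneg _)
  have h : ∀ N, ∑ n ∈ Finset.range N, w n * ‖c n a‖ ^ 2 ≤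
      Real.exp (2 * K * |a - b|) * ∑' n, w n * ‖c n b‖ ^ 2 := by
    intro N
    calc _ ≤ ∑ n ∈ Finset.range (N + 1), w n * ‖c n a‖ ^ 2 :=
          Finset.sum_le_sum_of_subset_of_nonneg
            (Finset.range_mono N.le_succ) fun n _ _ => h0 n
      _ ≤ _ := hc.sum_le_truncatedEnergy hw0 N a
      _ ≤ _ := hc.truncatedEnergy_le_exp_mul hw hw0 hK hwK N a b
      _ ≤ _ := by
        gcongr
        exact hc.truncatedEnergy_le_tsum hw N b hs
  exact ⟨summable_of_sum_range_le h0 h, Real.tsum_le_of_sum_range_le h0 h⟩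

end IsTranslationSystem

/-! ### Power weights -/

/-- The weight `(2n + 2 + B)^r`. -/
noncomputable def powerWeight (r B : ℝ) (n : ℕ) : ℝ := (2 * n + 2 + B) ^ r

lemma powerWeight_pos (r : ℝ) {B : ℝ} (hB : 0 ≤ B) (n : ℕ) : 0 < powerWeight r B n := by
  unfold powerWeight; positivity

lemma monotone_powerWeight {r B : ℝ} (hr : 0 ≤ r) (hB : 0 ≤ B) : Monotone (powerWeight r B) := by
  intro m n h
  unfold powerWeight
  gcongr

/-- From (1 + 2/x)^r ≤ e^y with y = 2r/x, and e^y - 1 ≤ y e^y; the assumption x ≥ 2 gives y ≤ r. No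
distinction between r < 1 and r ≥ 1 is needed. -/
lemma add_two_rpow_sub_le {r x : ℝ} (hr : 0 ≤ r) (hx : 2 ≤ x) :
    (x + 2) ^ r - x ^ r ≤ 2 * r * Real.exp r * x ^ r / x := by
  have hx0 : 0 < x := by linarith
  have h1 : (x + 2) ^ r = x ^ r * (1 + 2 / x) ^ r := by
    rw [← Real.mul_rpow hx0.le (by positivity)]
    congr 1
    field_simp
  have h2 : (1 + 2 / x) ^ r ≤ Real.exp (2 * r / x) := by
    calc (1 + 2 / x) ^ r ≤ Real.exp (2 / x) ^ r := by
          gcongr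
          linarith [Real.add_one_le_exp (2 / x)]
      _ = _ := by rw [← Real.exp_mul]; congr 1; ring
  have h3 : Real.exp (2 * r / x) - 1 ≤ 2 * r / x * Real.exp (2 * r / x) := by
    have := Real.add_one_le_exp (-(2 * r / x))
    have h4 := mul_le_mul_of_nonneg_left this (Real.exp_pos (2 * r / x)).le
    rw [← Real.exp_add] at h4
    simp at h4
    linarith
  have h5 : Real.exp (2 * r / x) ≤ Real.exp r := by
    apply Real.exp_le_exp.2
    rw [div_le_iff₀ hx0]
    nlinarith
  calc (x + 2) ^ r - x ^ r = x ^ r * ((1 + 2 / x) ^ r - 1) := by rw [h1]; ring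
    _ ≤ x ^ r * (2 * r / x * Real.exp r) := by
        gcongr
        refine (sub_le_sub_right h2 1).trans (h3.trans ?_)
        gcongr
    _ = _ := by ring

/-- The gain 1/√(1+B) comes from √(n+1) √(1+B) ≤ 2n+2+B: a larger shift B makes the weight vary more
slowly relative to its size. -/
lemma powerWeight_succ_sub_le {r B : ℝ} (hr : 0 ≤ r) (hB : 0 ≤ B) (n : ℕ) :
    (powerWeight r B (n + 1) - powerWeight r B n) * Real.sqrt (n + 1) ≤
      2 * r * Real.exp r / Real.sqrt (1 + B) * powerWeight r B n := by
  have hn : (0 : ℝ) ≤ n := n.cast_nonneg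
  have h := add_two_rpow_sub_le hr (x := 2 * n + 2 + B) (by linarith)
  have h0 : powerWeight r B (n + 1) = (2 * n + 2 + B + 2) ^ r := by
    unfold powerWeight
    congr 1
    push_cast
    ring
  rw [h0]
  set x : ℝ := 2 * n + 2 + B with hx
  have hx0 : 0 < x := by positivity
  change ((x + 2) ^ r - x ^ r) * _ ≤ _ * x ^ r
  have hs : Real.sqrt (n + 1) * Real.sqrt (1 + B) ≤ x := by
    rw [← Real.sqrt_mul (by positivity)]
    apply Real.sqrt_le_iff.2 ⟨hx0.le, ?_⟩
    nlinarith [mul_nonneg hn hB]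
  calc ((x + 2) ^ r - x ^ r) * Real.sqrt (n + 1)
      ≤ (2 * r * Real.exp r * x ^ r / x) * (x / Real.sqrt (1 + B)) := by
        gcongr
        rwa [le_div_iff₀ (by positivity)]
    _ = _ := by field_simp

/-! ### Translations of `L²(ℝ)` -/

/-- The translation `u ↦ u(· - a)` of `L²(ℝ)`. -/
noncomputable def translate (a : ℝ) : L2 →ₗᵢ[ℂ] L2 :=
  Lp.compMeasurePreservingₗᵢ ℂ (fun x => x - a) (measurePreserving_sub_right volume a)

lemma coeFn_translate (a : ℝ) (u : L2) : translate a u =ᵐ[volume] fun x => u (x - a) :=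
  Lp.coeFn_compMeasurePreserving u (measurePreserving_sub_right volume a)

lemma translate_zero (u : L2) : translate 0 u = u := by
  apply Lp.ext
  filter_upwards [coeFn_translate 0 u] with x hx
  rw [hx, sub_zero]

lemma translate_translate (a b : ℝ) (u : L2) :
    translate a (translate b u) = translate (a + b) u := by
  apply Lp.ext
  have h := (measurePreserving_sub_right volume a).quasiMeasurePreserving.ae
    (coeFn_translate b u)
  filter_upwards [coeFn_translate a (translate b u), coeFn_translate (a + b) u, h] with x h1 h2 h3
  rw [h1, h2, h3]
  congr 1
  ring

/-- Joint continuity is needed because, along characteristics, the shift and the translated function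
both vary with time. -/
lemma continuous_translate {Z : Type*} [TopologicalSpace Z] {a : Z → ℝ} {f : Z → L2}
    (ha : Continuous a) (hf : Continuous f) : Continuous fun z => translate (a z) (f z) := by
  let g : Z → C(ℝ, ℝ) := fun z => ⟨fun x => x - a z, by fun_prop⟩
  have hg : Continuous g :=
    ContinuousMap.continuous_of_continuous_uncurry _ (by
      change Continuous fun p : Z × ℝ => p.2 - a p.1
      fun_prop)
  exact hf.compMeasurePreservingLp hg (fun z => measurePreserving_sub_right volume (a z))
    (by norm_num)

lemma integral_mul_translate (G : ℝ → ℂ) (a : ℝ) (u : L2) :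
    ∫ x, G x * translate a u x = ∫ x, G (x + a) * u x := by
  have h : ∫ x, G x * translate a u x = ∫ x, (fun y => G (y + a) * u y) (x - a) := by
    apply integral_congr_ae
    filter_upwards [coeFn_translate a u] with x hx
    simp [hx]
  exact h.trans (integral_sub_right_eq_self (fun y => G (y + a) * u y) a)

/-! ### Hermite functions -/

/-- The polynomial factor of the Hermite function `h_n`. -/
noncomputable def normalizedHermite (n : ℕ) : Polynomial ℝ :=
  Polynomial.C (Real.sqrt (n.factorial * Real.sqrt Real.pi))⁻¹ * hermitePoly n

lemma hermiteFn_eq_normalizedHermite (n : ℕ) (x : ℝ) :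
    hermiteFn n x = (normalizedHermite n).eval x * Real.exp (-(1 / 2) * x ^ 2) := by
  rw [hermiteFn_eq]; rfl

lemma inv_sqrt_factorial_succ (n : ℕ) :
    (Real.sqrt (n.factorial * Real.sqrt Real.pi))⁻¹ =
      Real.sqrt (n + 1) * (Real.sqrt ((n + 1).factorial * Real.sqrt Real.pi))⁻¹ := by
  have h : ((n + 1).factorial : ℝ) * Real.sqrt Real.pi =
      (n + 1) * (n.factorial * Real.sqrt Real.pi) := by
    rw [Nat.factorial_succ]; push_cast; ring
  rw [h, Real.sqrt_mul (by positivity) (n.factorial * Real.sqrt Real.pi), mul_inv, ← mul_assoc,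
    mul_inv_cancel₀ (by positivity), one_mul]

lemma two_mul_sqrt_half (x : ℝ) : 2 * Real.sqrt (x / 2) = Real.sqrt 2 * Real.sqrt x := by
  rw [Real.sqrt_div' x (by norm_num)]
  have : Real.sqrt 2 * Real.sqrt 2 = 2 := Real.mul_self_sqrt (by norm_num)
  field_simp
  rw [sq, this, mul_comm]

lemma derivative_normalizedHermite (n : ℕ) :
    Polynomial.derivative (normalizedHermite n) =
      Polynomial.C (2 * Real.sqrt (n / 2)) * normalizedHermite (n - 1) := by
  cases n with
  | zero => simp [normalizedHermite, hermitePoly_zero]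
  | succ n =>
    rw [two_mul_sqrt_half]
    simp only [normalizedHermite, Nat.add_sub_cancel, Polynomial.derivative_C_mul,
      hermitePoly_derivative, inv_sqrt_factorial_succ n, Polynomial.smul_eq_C_mul]
    have h : (Polynomial.C ((n : ℝ) + 1)) =
        Polynomial.C (Real.sqrt (n + 1)) * Polynomial.C (Real.sqrt (n + 1)) := by
      rw [← Polynomial.C_mul, Real.mul_self_sqrt (by positivity)]
    push_cast
    simp only [Polynomial.C_mul, h]
    ring

/-- The recurrence `hermitePoly_succ` contains a derivative, which `derivative_normalizedHermite`
replaces by the preceding Hermite polynomial. -/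
lemma X_mul_normalizedHermite (n : ℕ) :
    Polynomial.X * normalizedHermite n =
      Polynomial.C (Real.sqrt (n / 2)) * normalizedHermite (n - 1) +
        Polynomial.C (Real.sqrt ((n + 1) / 2)) * normalizedHermite (n + 1) := by
  have h1 : Polynomial.C (2 * Real.sqrt ((n + 1) / 2)) * normalizedHermite (n + 1) =
      Polynomial.C 2 * Polynomial.X * normalizedHermite n -
        Polynomial.derivative (normalizedHermite n) := by
    rw [two_mul_sqrt_half]
    simp only [normalizedHermite, Polynomial.derivative_C_mul]
    rw [inv_sqrt_factorial_succ n]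
    simp only [Polynomial.C_mul]
    linear_combination (Polynomial.C (Real.sqrt (n + 1)) *
      Polynomial.C (Real.sqrt ((n + 1).factorial * Real.sqrt Real.pi))⁻¹) * hermitePoly_succ n
  rw [derivative_normalizedHermite, Polynomial.C_mul, Polynomial.C_mul] at h1
  have h2 : (Polynomial.C 2 : Polynomial ℝ) ≠ 0 := by simp
  apply mul_left_cancel₀ h2
  linear_combination -h1

lemma mul_hermiteFn (n : ℕ) (x : ℝ) :
    x * hermiteFn n x = Real.sqrt (n / 2) * hermiteFn (n - 1) x +
      Real.sqrt ((n + 1) / 2) * hermiteFn (n + 1) x := by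
  have h := congrArg (Polynomial.eval x) (X_mul_normalizedHermite n)
  simp only [Polynomial.eval_mul, Polynomial.eval_add, Polynomial.eval_C, Polynomial.eval_X] at h
  simp only [hermiteFn_eq_normalizedHermite]
  linear_combination Real.exp (-(1 / 2) * x ^ 2) * h

lemma hasDerivAt_hermiteFn (n : ℕ) (x : ℝ) :
    HasDerivAt (hermiteFn n) (Real.sqrt (n / 2) * hermiteFn (n - 1) x -
      Real.sqrt ((n + 1) / 2) * hermiteFn (n + 1) x) x := by
  have h := hasDerivAt_poly_mul_exp (normalizedHermite n) (1 / 2) x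
  convert! h using 1
  · exact funext (hermiteFn_eq_normalizedHermite n)
  · have h1 := congrArg (Polynomial.eval x) (X_mul_normalizedHermite n)
    simp only [Polynomial.eval_mul, Polynomial.eval_add, Polynomial.eval_sub, Polynomial.eval_C,
      Polynomial.eval_X, hermiteFn_eq_normalizedHermite, derivative_normalizedHermite] at h1 ⊢
    linear_combination Real.exp (-(1 / 2) * x ^ 2) * h1

lemma continuous_hermiteFn (n : ℕ) : Continuous (hermiteFn n) :=
  continuous_iff_continuousAt.2 fun x => (hasDerivAt_hermiteFn n x).continuousAt

lemma exists_poly_mul_exp_le (p : Polynomial ℝ) :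
    ∃ K, ∀ x : ℝ, |p.eval x * Real.exp (-(1 / 2) * x ^ 2)| ≤ K * Real.exp (-(1 / 4) * x ^ 2) := by
  induction p using Polynomial.induction_on' with
  | add p q hp hq =>
    obtain ⟨K, hK⟩ := hp
    obtain ⟨L, hL⟩ := hq
    refine ⟨K + L, fun x => ?_⟩
    rw [Polynomial.eval_add, add_mul, add_mul]
    exact (abs_add_le _ _).trans (add_le_add (hK x) (hL x))
  | monomial n c =>
    refine ⟨|c| * n.factorial * Real.exp 1, fun x => ?_⟩
    have h1 := Real.pow_div_factorial_le_exp |x| (abs_nonneg x) n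
    rw [div_le_iff₀ (by positivity)] at h1
    -- Half of the Gaussian decay pays for e^{|x|}, since |x| ≤ 1 + x²/4.
    have h2 : Real.exp |x| * Real.exp (-(1 / 2) * x ^ 2) ≤
        Real.exp 1 * Real.exp (-(1 / 4) * x ^ 2) := by
      rw [← Real.exp_add, ← Real.exp_add, Real.exp_le_exp, ← sq_abs x]
      nlinarith [sq_nonneg (|x| - 2)]
    rw [Polynomial.eval_monomial, abs_mul, abs_mul, abs_pow, Real.abs_exp]
    calc |c| * |x| ^ n * Real.exp (-(1 / 2) * x ^ 2)
        ≤ |c| * (Real.exp |x| * n.factorial) * Real.exp (-(1 / 2) * x ^ 2) := by gcongr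
      _ = |c| * n.factorial * (Real.exp |x| * Real.exp (-(1 / 2) * x ^ 2)) := by ring
      _ ≤ |c| * n.factorial * (Real.exp 1 * Real.exp (-(1 / 4) * x ^ 2)) := by gcongr
      _ = _ := by ring

lemma exists_hermiteFn_le (n : ℕ) :
    ∃ K, 0 ≤ K ∧ ∀ x : ℝ, |hermiteFn n x| ≤ K * Real.exp (-(1 / 4) * x ^ 2) := by
  obtain ⟨K, hK⟩ := exists_poly_mul_exp_le (normalizedHermite n)
  refine ⟨K, ?_, fun x => by simpa only [hermiteFn_eq_normalizedHermite] using hK x⟩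
  simpa using (abs_nonneg _).trans (hK 0)

lemma exp_neg_quarter_sq_add_le (x : ℝ) {δ : ℝ} (hδ : |δ| ≤ 1) :
    Real.exp (-(1 / 4) * (x + δ) ^ 2) ≤ Real.exp 1 * Real.exp (-(1 / 8) * x ^ 2) := by
  rw [← Real.exp_add, Real.exp_le_exp]
  have := (sq_le_one_iff_abs_le_one δ).2 hδ
  nlinarith [sq_nonneg (x + 2 * δ)]

/-! ### Hermite coefficients of translates -/

lemma integrable_hermiteFn_mul (n : ℕ) (a : ℝ) (u : L2) :
    Integrable fun x => ((hermiteFn n (x + a) : ℝ) : ℂ) * u x :=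
  ((memLp_hermiteFn n).comp_measurePreserving
    (measurePreserving_add_right volume a)).integrable_mul (Lp.memLp u)

/-- Dominated differentiation: moving the shift by at most 1 costs a factor e and weakens the
Gaussian rate from 1/4 to 1/8. The resulting majorant is still in L², hence integrable against u. -/
lemma hasDerivAt_integral_hermiteFn_mul (n : ℕ) (u : L2) (a : ℝ) :
    HasDerivAt (fun a => ∫ x, ((hermiteFn n (x + a) : ℝ) : ℂ) * u x)
      (∫ x, ((Real.sqrt (n / 2) * hermiteFn (n - 1) (x + a) -
        Real.sqrt ((n + 1) / 2) * hermiteFn (n + 1) (x + a) : ℝ) : ℂ) * u x) a := by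
  obtain ⟨K, hK0, hK⟩ := exists_hermiteFn_le (n - 1)
  obtain ⟨L, hL0, hL⟩ := exists_hermiteFn_le (n + 1)
  set D : ℝ := (Real.sqrt (n / 2) * K + Real.sqrt ((n + 1) / 2) * L) * Real.exp 1 with hD
  have hu : MemLp (u : ℝ → ℂ) 2 volume := Lp.memLp u
  have hg : MemLp (fun x : ℝ => ((Real.exp (-(1 / 8) * x ^ 2) : ℝ) : ℂ)) 2 volume := by
    simpa using memLp_poly_mul_exp 1 (b := 1 / 8) (by norm_num)
  have hg' := hg.comp_measurePreserving (measurePreserving_add_right volume a)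
  refine (hasDerivAt_integral_of_dominated_loc_of_deriv_le (s := Metric.ball a 1)
    (bound := fun x => D * ‖((Real.exp (-(1 / 8) * (x + a) ^ 2) : ℝ) : ℂ) * u x‖)
    (F' := fun b x => ((Real.sqrt (n / 2) * hermiteFn (n - 1) (x + b) -
        Real.sqrt ((n + 1) / 2) * hermiteFn (n + 1) (x + b) : ℝ) : ℂ) * u x)
    (Metric.ball_mem_nhds a one_pos)
    (Eventually.of_forall fun b => (integrable_hermiteFn_mul n b u).aestronglyMeasurable)
    (integrable_hermiteFn_mul n a u) ?_ ?_ ((hg'.integrable_mul hu).norm.const_mul D) ?_).2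
  · refine AEStronglyMeasurable.mul (Continuous.aestronglyMeasurable ?_) hu.aestronglyMeasurable
    have h1 := continuous_hermiteFn (n - 1)
    have h2 := continuous_hermiteFn (n + 1)
    fun_prop
  · refine Eventually.of_forall fun x b hb => ?_
    have hb' : |b - a| ≤ 1 := by
      rw [Metric.mem_ball, Real.dist_eq] at hb
      exact hb.le
    have he := exp_neg_quarter_sq_add_le (x + a) hb'
    rw [show x + a + (b - a) = x + b by ring] at he
    rw [norm_mul, norm_mul, ← mul_assoc, Complex.norm_real, Complex.norm_real, Real.norm_eq_abs,
      Real.norm_eq_abs, Real.abs_exp]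
    gcongr
    calc _ ≤ |Real.sqrt (n / 2) * hermiteFn (n - 1) (x + b)| +
          |Real.sqrt ((n + 1) / 2) * hermiteFn (n + 1) (x + b)| := abs_sub _ _
      _ = Real.sqrt (n / 2) * |hermiteFn (n - 1) (x + b)| +
          Real.sqrt ((n + 1) / 2) * |hermiteFn (n + 1) (x + b)| := by
          rw [abs_mul, abs_mul, abs_of_nonneg (Real.sqrt_nonneg _),
            abs_of_nonneg (Real.sqrt_nonneg _)]
      _ ≤ Real.sqrt (n / 2) * (K * (Real.exp 1 * Real.exp (-(1 / 8) * (x + a) ^ 2))) +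
          Real.sqrt ((n + 1) / 2) * (L * (Real.exp 1 * Real.exp (-(1 / 8) * (x + a) ^ 2))) := by
          gcongr
          · exact (hK _).trans (by gcongr)
          · exact (hL _).trans (by gcongr)
      _ = _ := by rw [hD]; ring
  · refine Eventually.of_forall fun x b _ => ?_
    have h := (hasDerivAt_hermiteFn n (x + b)).comp_const_add x b
    exact h.ofReal_comp.mul_const (u x)

/-- The `n`-th Hermite coefficient of `u(· - a)`. -/
noncomputable def coeff (u : L2) (n : ℕ) (a : ℝ) : ℂ := inner ℂ (hermiteBasis n) (translate a u)

lemma inner_hermiteBasis (n : ℕ) (u : L2) :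
    inner ℂ (hermiteBasis n) u = ∫ x, ((hermiteFn n x : ℝ) : ℂ) * u x := by
  rw [hermiteBasis, HilbertBasis.coe_mkOfOrthogonalEqBot, L2.inner_def]
  apply integral_congr_ae
  filter_upwards [(memLp_hermiteFn n).coeFn_toLp] with x hx
  rw [hermiteL2, hx, RCLike.inner_apply, Complex.conj_ofReal, mul_comm]

/-- With the shift placed on the smooth function h_n, the coefficient is differentiable in a for
every u in L². -/
lemma coeff_eq_integral (u : L2) (n : ℕ) (a : ℝ) :
    coeff u n a = ∫ x, ((hermiteFn n (x + a) : ℝ) : ℂ) * u x := by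
  rw [coeff, inner_hermiteBasis, integral_mul_translate (fun x => ((hermiteFn n x : ℝ) : ℂ))]

lemma hasSum_norm_inner_hermiteBasis (u : L2) :
    HasSum (fun n => ‖inner ℂ (hermiteBasis n) u‖ ^ 2) (‖u‖ ^ 2) := by
  have h := hermiteBasis.hasSum_inner_mul_inner u u
  rw [inner_self_eq_norm_sq_to_K] at h
  have h2 := Complex.hasSum_re h
  convert! h2 using 1
  · funext n
    exact ((inner_mul_symm_re_eq_norm (𝕜 := ℂ) u (hermiteBasis n)).trans (by
      rw [norm_mul, norm_inner_symm, sq])).symm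
  · norm_cast

theorem isTranslationSystem_coeff (u : L2) : IsTranslationSystem (coeff u) (‖u‖ ^ 2) where
  hasDerivAt n a := by
    have h := hasDerivAt_integral_hermiteFn_mul n u a
    rw [show coeff u n = _ from funext (coeff_eq_integral u n)]
    convert! h using 1
    rw [coeff_eq_integral, coeff_eq_integral, Complex.real_smul, Complex.real_smul,
      ← integral_const_mul, ← integral_const_mul, ← integral_sub
      ((integrable_hermiteFn_mul _ _ _).const_mul _) ((integrable_hermiteFn_mul _ _ _).const_mul _)]
    congr 1
    funext x
    push_cast
    ring
  hasSum a := by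
    rw [← (translate a).norm_map u]
    exact hasSum_norm_inner_hermiteBasis _

/-! ### Translates far away have small low Hermite modes -/

/-- Write a = (x + a) - x: the factor x + a acts on h_n(x + a) by the three-term recurrence, and the
remaining x falls on g. -/
lemma mul_coeff {g xg : L2} (h : ∀ᵐ x, xg x = (x : ℂ) * g x) (n : ℕ) (a : ℝ) :
    (a : ℂ) * coeff g n a = Real.sqrt (n / 2) * coeff g (n - 1) a +
      Real.sqrt ((n + 1) / 2) * coeff g (n + 1) a - coeff xg n a := by
  simp only [coeff_eq_integral, ← integral_const_mul]
  have h1 := (integrable_hermiteFn_mul (n - 1) a g).const_mul (Real.sqrt (n / 2) : ℂ)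
  have h2 := (integrable_hermiteFn_mul (n + 1) a g).const_mul (Real.sqrt ((n + 1) / 2) : ℂ)
  have h3 : Integrable fun x => (Real.sqrt (n / 2) : ℂ) * ((hermiteFn (n - 1) (x + a) : ℂ) * g x) +
      (Real.sqrt ((n + 1) / 2) : ℂ) * ((hermiteFn (n + 1) (x + a) : ℂ) * g x) := h1.add h2
  rw [← integral_add h1 h2, ← integral_sub h3 (integrable_hermiteFn_mul n a xg)]
  apply integral_congr_ae
  filter_upwards [h] with x hx
  have h1 : ((x : ℂ) + a) * hermiteFn n (x + a) =
      Real.sqrt (n / 2) * hermiteFn (n - 1) (x + a) +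
        Real.sqrt ((n + 1) / 2) * hermiteFn (n + 1) (x + a) := by
    exact_mod_cast mul_hermiteFn n (x + a)
  simp only [hx]
  linear_combination (g x) * h1

lemma sum_range_coeff_le (u : L2) (N : ℕ) (a : ℝ) :
    ∑ n ∈ Finset.range N, ‖coeff u n a‖ ^ 2 ≤ ‖u‖ ^ 2 :=
  (isTranslationSystem_coeff u).sum_le N a

lemma sq_mul_sum_coeff_le {g xg : L2} (h : ∀ᵐ x, xg x = (x : ℂ) * g x) (N : ℕ) (a : ℝ) :
    a ^ 2 * ∑ n ∈ Finset.range N, ‖coeff g n a‖ ^ 2 ≤ 9 * N * ‖g‖ ^ 2 + 3 * ‖xg‖ ^ 2 := by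
  have h1 : ∀ n ∈ Finset.range N, a ^ 2 * ‖coeff g n a‖ ^ 2 ≤
      3 * N * ‖coeff g (n - 1) a‖ ^ 2 + 3 * N * ‖coeff g (n + 1) a‖ ^ 2 +
        3 * ‖coeff xg n a‖ ^ 2 := by
    intro n hn
    have hnN : (n : ℝ) + 1 ≤ N := by exact_mod_cast Finset.mem_range.1 hn
    have hn0 : (0 : ℝ) ≤ n := n.cast_nonneg
    have e := congrArg norm (mul_coeff h n a)
    rw [norm_mul, Complex.norm_real, Real.norm_eq_abs] at e
    have e2 : |a| * ‖coeff g n a‖ ≤ Real.sqrt N * ‖coeff g (n - 1) a‖ +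
        Real.sqrt N * ‖coeff g (n + 1) a‖ + ‖coeff xg n a‖ := by
      rw [e]
      refine (norm_sub_le _ _).trans (add_le_add ((norm_add_le _ _).trans ?_) le_rfl)
      rw [norm_mul, norm_mul, Complex.norm_real, Complex.norm_real, Real.norm_eq_abs,
        Real.norm_eq_abs, abs_of_nonneg (Real.sqrt_nonneg _), abs_of_nonneg (Real.sqrt_nonneg _)]
      gcongr <;> linarith
    have e3 := pow_le_pow_left₀ (by positivity) e2 2
    have hN : Real.sqrt N ^ 2 = N := Real.sq_sqrt (by positivity)
    rw [mul_pow, sq_abs] at e3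
    refine e3.trans ?_
    have p := sq_nonneg (Real.sqrt N * ‖coeff g (n - 1) a‖ - Real.sqrt N * ‖coeff g (n + 1) a‖)
    have q := sq_nonneg (Real.sqrt N * ‖coeff g (n - 1) a‖ - ‖coeff xg n a‖)
    have r := sq_nonneg (Real.sqrt N * ‖coeff g (n + 1) a‖ - ‖coeff xg n a‖)
    generalize Real.sqrt N = b at *
    rw [← hN]
    linarith
  -- The truncated index counts mode 0 twice, whence the factor 2 and, in the end, 9 = 3 · (2 + 1).
  have h2 : ∑ n ∈ Finset.range N, ‖coeff g (n - 1) a‖ ^ 2 ≤ 2 * ‖g‖ ^ 2 := by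
    cases N with
    | zero => simp
    | succ N =>
      rw [Finset.sum_range_succ']
      have p := sum_range_coeff_le g N a
      have q := sum_range_coeff_le g 1 a
      simp only [Finset.sum_range_one] at q
      simp only [Nat.add_sub_cancel, Nat.zero_sub]
      linarith
  have h3 : ∑ n ∈ Finset.range N, ‖coeff g (n + 1) a‖ ^ 2 ≤ ‖g‖ ^ 2 := by
    have p := sum_range_coeff_le g (N + 1) a
    rw [Finset.sum_range_succ'] at p
    linarith [sq_nonneg ‖coeff g 0 a‖]
  have h4 := sum_range_coeff_le xg N a
  rw [Finset.mul_sum]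
  refine (Finset.sum_le_sum h1).trans ?_
  rw [Finset.sum_add_distrib, Finset.sum_add_distrib, ← Finset.mul_sum, ← Finset.mul_sum,
    ← Finset.mul_sum]
  calc _ ≤ 3 * N * (2 * ‖g‖ ^ 2) + 3 * N * ‖g‖ ^ 2 + 3 * ‖xg‖ ^ 2 := by gcongr
    _ = _ := by ring

lemma exists_approx_with_moment (u : L2) {η : ℝ} (hη : 0 < η) :
    ∃ g xg : L2, (∀ᵐ x, xg x = (x : ℂ) * g x) ∧ ‖u - g‖ ≤ η := by
  obtain ⟨g, hgs, hge, hgc, hgm⟩ := (Lp.memLp u).exists_hasCompactSupport_eLpNorm_sub_le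
    (by norm_num) (ε := ENNReal.ofReal η) (by simpa using hη)
  have hxm : MemLp (fun x : ℝ => (x : ℂ) * g x) 2 volume :=
    Continuous.memLp_of_hasCompactSupport (by fun_prop) hgs.mul_left
  refine ⟨hgm.toLp g, hxm.toLp _, ?_, ?_⟩
  · filter_upwards [hgm.coeFn_toLp, hxm.coeFn_toLp] with x h1 h2
    rw [h1, h2]
  · rw [Lp.norm_def]
    refine ENNReal.toReal_le_of_le_ofReal hη.le (le_trans (le_of_eq ?_) hge)
    apply eLpNorm_congr_ae
    filter_upwards [Lp.coeFn_sub u (hgm.toLp g), hgm.coeFn_toLp] with x h1 h2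
    rw [h1, Pi.sub_apply, h2, Pi.sub_apply]

/-- Since u need not have a first moment, it is replaced by some g with x g in L² and ‖u - g‖ ≤
‖u‖/2. The low modes of g contribute at most ‖u‖²/8 and those of u - g at most ‖u‖²/4; doubling both
gives 3/4. -/
theorem exists_low_modes_bound (u : L2) :
    ∃ δ > 0, ∀ (a : ℝ) (N : ℕ), (N : ℝ) ≤ δ * a ^ 2 →
      ∑ n ∈ Finset.range N, ‖coeff u n a‖ ^ 2 ≤ 3 / 4 * ‖u‖ ^ 2 := by
  rcases eq_or_ne u 0 with rfl | hu
  · exact ⟨1, one_pos, fun a N _ => by simp [coeff]⟩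
  have hu0 : 0 < ‖u‖ := norm_pos_iff.2 hu
  obtain ⟨g, xg, hx, hg⟩ := exists_approx_with_moment u (half_pos hu0)
  set D : ℝ := 9 * ‖g‖ ^ 2 + 3 * ‖xg‖ ^ 2 + 1 with hD
  have hD0 : 0 < D := by positivity
  -- This δ makes N D ≤ a² ‖u‖²/8. The case N = 0 is separate because ‖xg‖² is absorbed into N
  -- ‖xg‖².
  refine ⟨‖u‖ ^ 2 / (8 * D), by positivity, fun a N hN => ?_⟩
  rcases Nat.eq_zero_or_pos N with rfl | hNpos
  · simp only [Finset.range_zero, Finset.sum_empty]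
    positivity
  set δ := ‖u‖ ^ 2 / (8 * D) with hδ
  have hδ0 : 0 < δ := by positivity
  have hN1 : (1 : ℝ) ≤ N := by exact_mod_cast hNpos
  have ha : 0 < a ^ 2 := by
    by_contra hcon
    nlinarith [sq_nonneg a]
  have h1 : ∑ n ∈ Finset.range N, ‖coeff g n a‖ ^ 2 ≤ ‖u‖ ^ 2 / 8 := by
    have h := sq_mul_sum_coeff_le hx N a
    have h2 : 9 * N * ‖g‖ ^ 2 + 3 * ‖xg‖ ^ 2 ≤ (δ * a ^ 2) * D := by
      calc 9 * N * ‖g‖ ^ 2 + 3 * ‖xg‖ ^ 2 ≤ 9 * N * ‖g‖ ^ 2 + 3 * N * ‖xg‖ ^ 2 + N := by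
            nlinarith [sq_nonneg ‖xg‖]
        _ = N * D := by rw [hD]; ring
        _ ≤ _ := by gcongr
    have h3 : (δ * a ^ 2) * D = a ^ 2 * (‖u‖ ^ 2 / 8) := by
      rw [hδ]; field_simp
    exact le_of_mul_le_mul_left (h.trans (h2.trans h3.le)) ha
  have h2 : ∑ n ∈ Finset.range N, ‖coeff (u - g) n a‖ ^ 2 ≤ ‖u‖ ^ 2 / 4 := by
    refine (sum_range_coeff_le _ N a).trans ?_
    calc ‖u - g‖ ^ 2 ≤ (‖u‖ / 2) ^ 2 := by gcongr
      _ = _ := by ring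
  have h3 : ∀ n, ‖coeff u n a‖ ^ 2 ≤ 2 * ‖coeff g n a‖ ^ 2 + 2 * ‖coeff (u - g) n a‖ ^ 2 := by
    intro n
    have e : coeff u n a = coeff g n a + coeff (u - g) n a := by
      simp only [coeff, map_sub, inner_sub_right]
      ring
    rw [e]
    have := pow_le_pow_left₀ (norm_nonneg _) (norm_add_le (coeff g n a) (coeff (u - g) n a)) 2
    nlinarith [sq_nonneg (‖coeff g n a‖ - ‖coeff (u - g) n a‖)]
  refine (Finset.sum_le_sum fun n _ => h3 n).trans ?_
  rw [Finset.sum_add_distrib, ← Finset.mul_sum, ← Finset.mul_sum]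
  linarith

/-! ### The transport equation in `L²(ℝ)` -/

/-- `i ∂ₜ U = -i ε ∂ₓ U` in the sense of distributions on `ℝ × ℝ`. -/
def IsWeakTransport (ε : ℝ) (U : ℝ → L2) : Prop :=
  ∀ φ : ℝ × ℝ → ℂ, ContDiff ℝ ∞ φ → HasCompactSupport φ →
    Complex.I * (-∫ t : ℝ, ∫ x : ℝ, U t x * fderiv ℝ φ (t, x) (1, 0)) =
      -(Complex.I * ε) * (-∫ t : ℝ, ∫ x : ℝ, U t x * fderiv ℝ φ (t, x) (0, 1))

lemma transport_identity_iff (ε : ℝ) (A B : ℂ) :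
    Complex.I * (-A) = -(Complex.I * ε) * (-B) ↔ A + ε * B = 0 := by
  constructor
  · intro h
    apply mul_left_cancel₀ Complex.I_ne_zero
    linear_combination -h
  · intro h
    linear_combination -Complex.I * h

lemma hasCompactSupport_comp_curve {E : Type*} [NormedAddCommGroup E] {ψ : ℝ × ℝ → E}
    (hψ : HasCompactSupport ψ) (f : ℝ → ℝ) : HasCompactSupport fun t => ψ (t, f t) := by
  refine HasCompactSupport.intro (hψ.isCompact.image continuous_fst) fun t ht => ?_
  exact image_eq_zero_of_notMem_tsupport fun h => ht ⟨_, h, rfl⟩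

lemma integrable_snd_mul {ψ : ℝ × ℝ → ℂ} (hc : Continuous ψ) (hψ : HasCompactSupport ψ) (u : L2) :
    Integrable (fun z : ℝ × ℝ => u z.2 * ψ z) (volume.prod volume) := by
  obtain ⟨C, hC⟩ := hc.bounded_above_of_compact_support hψ
  set K₁ := Prod.fst '' tsupport ψ
  set K₂ := Prod.snd '' tsupport ψ
  have hK₁ : IsCompact K₁ := hψ.isCompact.image continuous_fst
  have hK₂ : IsCompact K₂ := hψ.isCompact.image continuous_snd
  have h1 : Integrable (K₁.indicator fun _ => C) volume :=
    (integrable_indicator_iff hK₁.measurableSet).2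
      (continuous_const.continuousOn.integrableOn_compact hK₁)
  have h2 : Integrable (K₂.indicator fun x => ‖u x‖) volume :=
    (integrable_indicator_iff hK₂.measurableSet).2
      (((Lp.memLp u).locallyIntegrable (by norm_num)).integrableOn_isCompact hK₂).norm
  refine (h1.mul_prod h2).mono' ?_ (Eventually.of_forall fun z => ?_)
  · exact ((Lp.aestronglyMeasurable u).comp_quasiMeasurePreserving
      Measure.quasiMeasurePreserving_snd).mul hc.aestronglyMeasurable
  · by_cases hz : z ∈ tsupport ψ
    · rw [Set.indicator_of_mem (Set.mem_image_of_mem _ hz),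
        Set.indicator_of_mem (Set.mem_image_of_mem _ hz), norm_mul, mul_comm]
      gcongr
      exact hC z
    · rw [image_eq_zero_of_notMem_tsupport hz, mul_zero, norm_zero]
      have hC0 : 0 ≤ C := (norm_nonneg _).trans (hC z)
      exact mul_nonneg (Set.indicator_nonneg (fun _ _ => hC0) _)
        (Set.indicator_nonneg (fun _ _ => norm_nonneg _) _)

/-- The shear `(t, x) ↦ (t, x + ε t)`. -/
def shear (ε : ℝ) : ℝ × ℝ ≃ₜ ℝ × ℝ where
  toFun z := (z.1, z.2 + ε * z.1)
  invFun z := (z.1, z.2 - ε * z.1)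
  left_inv z := by simp
  right_inv z := by simp
  continuous_toFun := by fun_prop
  continuous_invFun := by fun_prop

/-- The substitution x ↦ x + εt transfers the motion to the test function. The two derivatives
combine into the one along (1, ε), which is d/dt of φ(t, x + εt); by Fubini, integrating first in t
gives zero. -/
theorem isWeakTransport_translate (ε : ℝ) (u : L2) :
    IsWeakTransport ε fun t => translate (ε * t) u := by
  intro φ hφ hs
  rw [transport_identity_iff]
  have hcd : Continuous (fderiv ℝ φ) := hφ.continuous_fderiv (by simp)
  have hsd : HasCompactSupport (fderiv ℝ φ) := hs.fderiv ℝ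
  have hc : ∀ v : ℝ × ℝ, Continuous fun z => fderiv ℝ φ (shear ε z) v := fun v =>
    (hcd.comp (shear ε).continuous).clm_apply continuous_const
  have hcs : ∀ v : ℝ × ℝ, HasCompactSupport fun z => fderiv ℝ φ (shear ε z) v := fun v =>
    (hsd.comp_homeomorph (shear ε)).comp_left (g := fun L : ℝ × ℝ →L[ℝ] ℂ => L v) rfl
  have hint := fun v => integrable_snd_mul (hc v) (hcs v) u
  have key : ∀ v : ℝ × ℝ, ∫ t : ℝ, ∫ x : ℝ, translate (ε * t) u x * fderiv ℝ φ (t, x) v =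
      ∫ z : ℝ × ℝ, u z.2 * fderiv ℝ φ (shear ε z) v ∂(volume.prod volume) := by
    intro v
    rw [integral_prod _ (hint v)]
    congr 1
    funext t
    have := integral_mul_translate (fun x => fderiv ℝ φ (t, x) v) (ε * t) u
    simp only [mul_comm (fderiv ℝ φ _ v)] at this
    exact this
  rw [key, key, ← integral_const_mul, ← integral_add (hint _) ((hint _).const_mul _)]
  have h1 : ∀ z : ℝ × ℝ, u z.2 * fderiv ℝ φ (shear ε z) (1, 0) +
      ε * (u z.2 * fderiv ℝ φ (shear ε z) (0, 1)) = u z.2 * fderiv ℝ φ (shear ε z) (1, ε) := by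
    intro z
    have : ((1, ε) : ℝ × ℝ) = (1, 0) + ε • (0, 1) := by simp
    rw [this, map_add, map_smul, Complex.real_smul]
    ring
  simp only [h1]
  rw [integral_prod_symm _ (hint _)]
  have h2 : ∀ x : ℝ, ∫ t : ℝ, u x * fderiv ℝ φ (shear ε (t, x)) (1, ε) = 0 := by
    intro x
    rw [integral_const_mul]
    have hd : ∀ t, HasDerivAt (fun t : ℝ => φ (t, x + ε * t))
        (fderiv ℝ φ (t, x + ε * t) (1, ε)) t := by
      intro t
      have hφd := (hφ.differentiable (by simp) (t, x + ε * t)).hasFDerivAt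
      refine hφd.comp_hasDerivAt t ((hasDerivAt_id t).prodMk ?_)
      simpa using ((hasDerivAt_id t).const_mul ε).const_add x
    have h3 := integral_eq_zero_of_hasDerivAt_of_integrable hd
      (Continuous.integrable_of_hasCompactSupport
        ((hc (1, ε)).comp (Continuous.prodMk continuous_id continuous_const))
        (hasCompactSupport_comp_curve (hcs (1, ε)) fun _ => x))
      (Continuous.integrable_of_hasCompactSupport (hφ.continuous.comp (by fun_prop))
        (hasCompactSupport_comp_curve hs _))
    rw [show (∫ t : ℝ, fderiv ℝ φ (shear ε (t, x)) (1, ε)) = 0 from h3, mul_zero]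
  simp only [h2, integral_zero]

/-- A continuous function with vanishing distributional derivative is constant. -/
lemma eq_of_integral_deriv_smul_eq_zero {g : ℝ → ℂ} (hg : Continuous g)
    (h : ∀ χ : ℝ → ℝ, ContDiff ℝ ∞ χ → HasCompactSupport χ → ∫ t, deriv χ t • g t = 0)
    (a b : ℝ) : g a = g b := by
  -- Mollify g by shrinking bumps. The derivative of each mollification at x pairs g with the
  -- derivative of a test function reflected about x, so each mollification is constant, and the
  -- limit transfers this to g.
  let φ : ℕ → ContDiffBump (0 : ℝ) := fun n =>
    ⟨1 / (2 * ((n : ℝ) + 1)), 1 / ((n : ℝ) + 1), by positivity, by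
      rw [one_div_lt_one_div (by positivity) (by positivity)]
      linarith [n.cast_nonneg (α := ℝ)]⟩
  have hφ : Tendsto (fun n => (φ n).rOut) atTop (𝓝 0) := tendsto_one_div_add_atTop_nhds_zero_nat
  have hlim := ContDiffBump.convolution_tendsto_right_of_continuous (μ := volume) hφ hg
  refine tendsto_nhds_unique (hlim a) (Tendsto.congr (fun n => ?_) (hlim b))
  have hcs : HasCompactSupport ((φ n).normed volume) := (φ n).hasCompactSupport_normed
  have hcd : ContDiff ℝ ∞ ((φ n).normed volume) := (φ n).contDiff_normed
  have hd := hcs.hasDerivAt_convolution_left (ContinuousLinearMap.lsmul ℝ ℝ) (μ := volume)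
    (hcd.of_le (by simp)) hg.locallyIntegrable
  refine is_const_of_deriv_eq_zero (fun x => (hd x).differentiableAt) (fun x => ?_) b a
  rw [(hd x).deriv, convolution_def, ← integral_sub_left_eq_self _ _ x]
  have h1 := h (fun t => (φ n).normed volume (x - t)) (by fun_prop)
    (hcs.comp_homeomorph (Homeomorph.subLeft x))
  rw [← neg_eq_zero, ← h1, ← integral_neg]
  congr 1
  funext t
  rw [deriv_comp_const_sub]
  simp

lemma continuous_integral_mul_translate {U : ℝ → L2} (hU : Continuous U) (ε : ℝ) {ψ : ℝ → ℝ}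
    (hψ : Continuous ψ) (hs : HasCompactSupport ψ) :
    Continuous fun t => ∫ x, (ψ x : ℂ) * translate (-(ε * t)) (U t) x := by
  have hm : MemLp (fun x => (ψ x : ℂ)) 2 volume :=
    Continuous.memLp_of_hasCompactSupport (by fun_prop)
      (hs.comp_left (g := fun y : ℝ => (y : ℂ)) Complex.ofReal_zero)
  have h : ∀ v : L2, ∫ x, (ψ x : ℂ) * v x = inner ℂ (hm.toLp _) v := by
    intro v
    rw [L2.inner_def]
    apply integral_congr_ae
    filter_upwards [hm.coeFn_toLp] with x hx
    rw [hx, RCLike.inner_apply, Complex.conj_ofReal, mul_comm]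
  simp only [h]
  exact continuous_const.inner (continuous_translate (by fun_prop) hU)

/-- Seen along characteristics, the solution is stationary: its pairing with each ψ is continuous in
t with vanishing weak derivative, hence constant, and the functions ψ separate points of L². -/
theorem IsWeakTransport.eq_translate {ε : ℝ} {U : ℝ → L2} (h : IsWeakTransport ε U)
    (hU : Continuous U) (t : ℝ) : U t = translate (ε * t) (U 0) := by
  have hconst : ∀ ψ : ℝ → ℝ, ContDiff ℝ ∞ ψ → HasCompactSupport ψ →
      ∫ x, (ψ x : ℂ) * translate (-(ε * t)) (U t) x =
        ∫ x, (ψ x : ℂ) * translate (-(ε * 0)) (U 0) x := by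
    intro ψ hψ hψs
    have hψ' : ContDiff ℝ ∞ (deriv ψ) := hψ.deriv'
    set G : (ℝ → ℝ) → ℝ → ℂ := fun f t => ∫ x, (f x : ℂ) * translate (-(ε * t)) (U t) x with hG
    have hG_eq : ∀ f t, G f t = ∫ x, (f (x - ε * t) : ℂ) * U t x := by
      intro f t
      simp only [hG]
      rw [integral_mul_translate (fun x => (f x : ℂ))]
      simp only [sub_eq_add_neg]
    have hGψ := continuous_integral_mul_translate hU ε hψ.continuous hψs
    have hGψ' := continuous_integral_mul_translate hU ε hψ'.continuous hψs.deriv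
    refine eq_of_integral_deriv_smul_eq_zero (g := G ψ) hGψ (fun χ hχ hχs => ?_) t 0
    -- The profile ψ(x - εt) is itself transported, so the terms containing ψ' cancel and only χ'
    -- times the pairing remains.
    set φ : ℝ × ℝ → ℂ := fun z => ((χ z.1 * ψ (z.2 - ε * z.1) : ℝ) : ℂ) with hφ
    have hφc : ContDiff ℝ ∞ φ := by
      refine Complex.ofRealCLM.contDiff.comp ?_
      exact (hχ.comp contDiff_fst).mul
        (hψ.comp (contDiff_snd.sub (contDiff_const.mul contDiff_fst)))
    have hφs : HasCompactSupport φ := by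
      have h1 : HasCompactSupport fun z : ℝ × ℝ => χ z.1 * ψ z.2 := by
        refine HasCompactSupport.intro (hχs.isCompact.prod hψs.isCompact) fun z hz => ?_
        rw [Set.mem_prod, not_and_or] at hz
        rcases hz with hz | hz <;> rw [image_eq_zero_of_notMem_tsupport hz] <;> simp
      exact (h1.comp_homeomorph (shear ε).symm).comp_left (g := fun y : ℝ => (y : ℂ))
        Complex.ofReal_zero
    have hd : ∀ z : ℝ × ℝ, HasFDerivAt φ (fderiv ℝ φ z) z := fun z =>
      (hφc.differentiable (by simp) z).hasFDerivAt
    have hχd : ∀ t, HasDerivAt χ (deriv χ t) t := fun t =>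
      (hχ.differentiable (by simp) t).hasDerivAt
    have hψd : ∀ t, HasDerivAt ψ (deriv ψ t) t := fun t =>
      (hψ.differentiable (by simp) t).hasDerivAt
    have hφt : ∀ t x, fderiv ℝ φ (t, x) (1, 0) =
        ((deriv χ t * ψ (x - ε * t) - ε * χ t * deriv ψ (x - ε * t) : ℝ) : ℂ) := by
      intro t x
      have h1 : HasDerivAt (fun t => φ (t, x)) (fderiv ℝ φ (t, x) (1, 0)) t :=
        (hd (t, x)).comp_hasDerivAt t ((hasDerivAt_id t).prodMk (hasDerivAt_const t x))
      have h2 : HasDerivAt (fun t => x - ε * t) (-ε) t := by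
        simpa using ((hasDerivAt_id t).const_mul ε).const_sub x
      have h3 := ((hχd t).mul ((hψd (x - ε * t)).comp t h2)).ofReal_comp
      rw [h1.unique h3]
      congr 1
      simp only [Function.comp_apply]
      ring
    have hφx : ∀ t x, fderiv ℝ φ (t, x) (0, 1) = ((χ t * deriv ψ (x - ε * t) : ℝ) : ℂ) := by
      intro t x
      have h1 : HasDerivAt (fun x => φ (t, x)) (fderiv ℝ φ (t, x) (0, 1)) x :=
        (hd (t, x)).comp_hasDerivAt x ((hasDerivAt_const x t).prodMk (hasDerivAt_id x))
      have h3 := (((hψd (x - ε * t)).comp_sub_const x (ε * t)).const_mul (χ t)).ofReal_comp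
      exact h1.unique h3
    have hint : ∀ f : ℝ → ℝ, Continuous f → HasCompactSupport f → ∀ t,
        Integrable fun x => (f (x - ε * t) : ℂ) * U t x := by
      intro f hf hfs t
      have hm : MemLp (fun x => (f (x - ε * t) : ℂ)) 2 volume :=
        Continuous.memLp_of_hasCompactSupport (by fun_prop)
          ((hfs.comp_homeomorph (Homeomorph.subRight (ε * t))).comp_left
            (g := fun y : ℝ => (y : ℂ)) Complex.ofReal_zero)
      exact hm.integrable_mul (Lp.memLp (U t))
    have hI1 : ∀ t, ∫ x, U t x * fderiv ℝ φ (t, x) (1, 0) =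
        deriv χ t • G ψ t - (ε : ℂ) * (χ t • G (deriv ψ) t) := by
      intro t
      rw [hG_eq, hG_eq, Complex.real_smul, Complex.real_smul, ← integral_const_mul,
        ← integral_const_mul, ← integral_const_mul, ← integral_sub
        ((hint ψ hψ.continuous hψs t).const_mul _)
        (((hint _ hψ'.continuous hψs.deriv t).const_mul _).const_mul _)]
      congr 1
      funext x
      rw [hφt]
      push_cast
      ring
    have hI2 : ∀ t, ∫ x, U t x * fderiv ℝ φ (t, x) (0, 1) = χ t • G (deriv ψ) t := by
      intro t
      rw [hG_eq, Complex.real_smul, ← integral_const_mul]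
      congr 1
      funext x
      rw [hφx]
      push_cast
      ring
    have hw := (transport_identity_iff _ _ _).1 (h φ hφc hφs)
    simp only [hI1, hI2] at hw
    have i1 : Integrable fun t => deriv χ t • G ψ t :=
      Continuous.integrable_of_hasCompactSupport ((hχ.continuous_deriv (by simp)).smul hGψ)
        hχs.deriv.smul_right
    have i2 : Integrable fun t => χ t • G (deriv ψ) t :=
      Continuous.integrable_of_hasCompactSupport (hχ.continuous.smul hGψ') hχs.smul_right
    rw [integral_sub i1 (i2.const_mul _), integral_const_mul] at hw
    linear_combination hw
  have hdiff : translate (-(ε * t)) (U t) - U 0 = 0 := by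
    rw [Lp.eq_zero_iff_ae_eq_zero]
    refine ae_eq_zero_of_integral_contDiff_smul_eq_zero
      ((Lp.memLp _).locallyIntegrable (by norm_num)) fun ψ hψ hψs => ?_
    have hm : MemLp (fun x => (ψ x : ℂ)) 2 volume :=
      Continuous.memLp_of_hasCompactSupport (by have := hψ.continuous; fun_prop)
        (hψs.comp_left (g := fun y : ℝ => (y : ℂ)) Complex.ofReal_zero)
    have h1 := hconst ψ hψ hψs
    have hi : ∀ v : L2, Integrable fun x => (ψ x : ℂ) * v x := fun v =>
      hm.integrable_mul (Lp.memLp v)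
    rw [mul_zero, neg_zero, translate_zero, ← sub_eq_zero, ← integral_sub (hi _) (hi _)] at h1
    rw [← h1]
    apply integral_congr_ae
    filter_upwards [Lp.coeFn_sub (translate (-(ε * t)) (U t)) (U 0)] with x hx
    rw [hx, Pi.sub_apply, Complex.real_smul, mul_sub]
  rw [← sub_eq_zero.1 hdiff, translate_translate, add_neg_cancel, translate_zero]

/-! ### Elementary facts on the bracket and the weight -/

lemma japaneseBracket_rpow_sq (a r : ℝ) :
    (japaneseBracket a ^ r) ^ 2 = (1 + a ^ 2) ^ r := by
  rw [japaneseBracket, Real.sqrt_eq_rpow, ← Real.rpow_mul (by positivity), ← Real.rpow_mul_natCast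
    (by positivity)]
  congr 1
  push_cast
  ring

lemma one_le_powerWeight {r : ℝ} (hr : 0 ≤ r) (n : ℕ) : 1 ≤ powerWeight r 0 n :=
  Real.one_le_rpow (by linarith [n.cast_nonneg (α := ℝ)]) hr

/-! ### Coefficient description of `ℍ̃^s` -/

namespace HSpace

variable {τ s : ℝ}

/-- H + 1 has eigenvalues 2n + 2, and the exponents multiply to ρ(τ) · (s/2) · 2 = s/(2(1-τ)), the
growth exponent of the theorem. -/
lemma sq_symbol_eq (τ s : ℝ) (n : ℕ) :
    ((((2 * (n : ℝ) + 1) + 1) ^ rho τ) ^ (s / 2)) ^ 2 = powerWeight (s / (2 * (1 - τ))) 0 n := by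
  rw [← Real.rpow_mul (by positivity), ← Real.rpow_mul_natCast (by positivity), powerWeight, rho]
  congr 1
  · ring
  · push_cast
    ring

lemma hasSum_norm_sq (u : HSpace τ s) :
    HasSum (fun n => powerWeight (s / (2 * (1 - τ))) 0 n *
      ‖inner ℂ (hermiteBasis n) u.toL2‖ ^ 2) (‖u‖ ^ 2) := by
  rw [norm_def]
  convert! hasSum_norm_inner_hermiteBasis u.halfPow using 1
  funext n
  have h := inner_oscillatorCalculus (fun l => ((l + 1) ^ rho τ) ^ (s / 2)) u n
  have h' : inner ℂ (hermiteBasis n) u.halfPow =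
    (((((2 * (n : ℝ) + 1) + 1) ^ rho τ) ^ (s / 2) : ℝ) : ℂ) *
      inner ℂ (hermiteBasis n) u.toL2 := h
  rw [h', norm_mul, mul_pow, Complex.norm_real, Real.norm_eq_abs, sq_abs, sq_symbol_eq]

lemma exists_toL2_eq {v : L2} (h : Summable fun n => powerWeight (s / (2 * (1 - τ))) 0 n *
    ‖inner ℂ (hermiteBasis n) v‖ ^ 2) : ∃ u : HSpace τ s, u.toL2 = v := by
  refine ⟨⟨v, ?_⟩, rfl⟩
  change Memℓp _ 2
  rw [memℓp_gen_iff (by norm_num)]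
  convert! h using 2 with n
  rw [norm_mul, Complex.norm_real, Real.norm_eq_abs, ENNReal.toReal_ofNat, Real.rpow_two, mul_pow,
    sq_abs, sq_symbol_eq]

lemma toL2_injective : Function.Injective (toL2 : HSpace τ s → L2) := Subtype.val_injective

lemma norm_toL2_le (hr : 0 ≤ s / (2 * (1 - τ))) (u : HSpace τ s) : ‖u.toL2‖ ≤ ‖u‖ := by
  apply le_of_sq_le_sq _ (norm_nonneg u)
  refine hasSum_le (fun n => ?_) (hasSum_norm_inner_hermiteBasis u.toL2) u.hasSum_norm_sq
  exact le_mul_of_one_le_left (sq_nonneg _) (one_le_powerWeight hr n)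

lemma continuous_toL2 (hr : 0 ≤ s / (2 * (1 - τ))) : Continuous (toL2 : HSpace τ s → L2) :=
  AddMonoidHomClass.continuous_of_bound toL2 1 fun u => by
    rw [one_mul]; exact norm_toL2_le hr u

/-! ### Translations of `ℍ̃^s` -/

lemma hasSum_coeff_zero (u : HSpace τ s) :
    HasSum (fun n => powerWeight (s / (2 * (1 - τ))) 0 n * ‖coeff u.toL2 n 0‖ ^ 2) (‖u‖ ^ 2) := by
  simpa only [coeff, translate_zero] using u.hasSum_norm_sq

lemma hasSum_coeff {u v : HSpace τ s} {a : ℝ} (h : v.toL2 = translate a u.toL2) :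
    HasSum (fun n => powerWeight (s / (2 * (1 - τ))) 0 n * ‖coeff u.toL2 n a‖ ^ 2)
      (‖v‖ ^ 2) := by
  simpa only [coeff, h] using v.hasSum_norm_sq

lemma exists_translate (hr : 0 ≤ s / (2 * (1 - τ))) (u : HSpace τ s) (a : ℝ) :
    ∃ v : HSpace τ s, v.toL2 = translate a u.toL2 := by
  refine exists_toL2_eq ((isTranslationSystem_coeff u.toL2).weighted_tsum_le
    (monotone_powerWeight hr le_rfl) (fun n => (powerWeight_pos _ le_rfl n).le) (by positivity)
    (powerWeight_succ_sub_le hr le_rfl) a 0 u.hasSum_coeff_zero.summable).1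

/-- The case B = 0 of the energy estimate. Its exponential growth is too weak for large shifts, but
its factor tends to 1 as a → b, which serves continuity. -/
lemma norm_sq_le_exp_mul (hr : 0 ≤ s / (2 * (1 - τ))) {u v w : HSpace τ s} {a b : ℝ}
    (hv : v.toL2 = translate a u.toL2) (hw : w.toL2 = translate b u.toL2) :
    ‖v‖ ^ 2 ≤ Real.exp (2 * (2 * (s / (2 * (1 - τ))) * Real.exp (s / (2 * (1 - τ))) /
      Real.sqrt (1 + 0)) * |a - b|) * ‖w‖ ^ 2 := by
  rw [← (hasSum_coeff hv).tsum_eq, ← (hasSum_coeff hw).tsum_eq]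
  exact ((isTranslationSystem_coeff u.toL2).weighted_tsum_le
    (monotone_powerWeight hr le_rfl) (fun n => (powerWeight_pos _ le_rfl n).le) (by positivity)
    (powerWeight_succ_sub_le hr le_rfl) a b (hasSum_coeff hw).summable).2

/-- The weight is adapted to the final shift by B = a². The Grönwall factor is then bounded because
|a| ≤ √(1+a²), and the only loss is 2n+2+a² ≤ (1+a²)(2n+2) at the initial point. -/
theorem norm_translate_le (hr : 0 ≤ s / (2 * (1 - τ))) {u v : HSpace τ s} {a : ℝ}
    (hv : v.toL2 = translate a u.toL2) :
    ‖v‖ ≤ Real.exp (2 * (s / (2 * (1 - τ))) * Real.exp (s / (2 * (1 - τ)))) *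
      japaneseBracket a ^ (s / (2 * (1 - τ))) * ‖u‖ := by
  have hsv := hasSum_coeff hv
  have hsu := u.hasSum_coeff_zero
  set r := s / (2 * (1 - τ)) with hr_def
  have hb : 0 ≤ japaneseBracket a := Real.sqrt_nonneg _
  apply le_of_sq_le_sq _ (by positivity)
  rw [mul_pow, mul_pow, japaneseBracket_rpow_sq, ← Real.exp_nat_mul]
  have hle : ∀ n, powerWeight r (a ^ 2) n ≤ (1 + a ^ 2) ^ r * powerWeight r 0 n := by
    intro n
    unfold powerWeight
    rw [← Real.mul_rpow (by positivity) (by positivity)]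
    have := mul_nonneg (sq_nonneg a) (n.cast_nonneg (α := ℝ))
    gcongr
    nlinarith [sq_nonneg a]
  have hge : ∀ n, powerWeight r 0 n ≤ powerWeight r (a ^ 2) n := by
    intro n
    unfold powerWeight
    gcongr
    positivity
  have hs0 : Summable fun n => powerWeight r (a ^ 2) n * ‖coeff u.toL2 n 0‖ ^ 2 := by
    refine Summable.of_nonneg_of_le (fun n => mul_nonneg (powerWeight_pos _ (sq_nonneg a) n).le
      (sq_nonneg _)) (fun n => ?_) (hsu.summable.mul_left ((1 + a ^ 2) ^ r))
    rw [← mul_assoc]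
    exact mul_le_mul_of_nonneg_right (hle n) (sq_nonneg _)
  obtain ⟨h1, h2⟩ := (isTranslationSystem_coeff u.toL2).weighted_tsum_le
    (monotone_powerWeight hr (sq_nonneg a)) (fun n => (powerWeight_pos _ (sq_nonneg a) n).le)
    (by positivity) (powerWeight_succ_sub_le hr (sq_nonneg a)) a 0 hs0
  rw [sub_zero] at h2
  have hexp : 2 * (2 * r * Real.exp r / Real.sqrt (1 + a ^ 2)) * |a| ≤
      (2 : ℕ) * (2 * r * Real.exp r) := by
    have ha : |a| ≤ Real.sqrt (1 + a ^ 2) := Real.abs_le_sqrt (by linarith)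
    have hpos : 0 < Real.sqrt (1 + a ^ 2) := by positivity
    calc 2 * (2 * r * Real.exp r / Real.sqrt (1 + a ^ 2)) * |a|
        ≤ 2 * (2 * r * Real.exp r / Real.sqrt (1 + a ^ 2)) * Real.sqrt (1 + a ^ 2) := by gcongr
      _ = _ := by push_cast; field_simp
  calc ‖v‖ ^ 2 = ∑' n, powerWeight r 0 n * ‖coeff u.toL2 n a‖ ^ 2 := hsv.tsum_eq.symm
    _ ≤ ∑' n, powerWeight r (a ^ 2) n * ‖coeff u.toL2 n a‖ ^ 2 :=
        hsv.summable.tsum_le_tsum (fun n => mul_le_mul_of_nonneg_right (hge n) (sq_nonneg _)) h1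
    _ ≤ _ := h2
    _ ≤ Real.exp ((2 : ℕ) * (2 * r * Real.exp r)) *
          ∑' n, (1 + a ^ 2) ^ r * (powerWeight r 0 n * ‖coeff u.toL2 n 0‖ ^ 2) := by
        refine mul_le_mul (Real.exp_le_exp.2 hexp) ?_ (tsum_nonneg fun n => mul_nonneg
          (powerWeight_pos _ (sq_nonneg a) n).le (sq_nonneg _)) (Real.exp_pos _).le
        refine hs0.tsum_le_tsum (fun n => ?_) (hsu.summable.mul_left _)
        rw [← mul_assoc]
        exact mul_le_mul_of_nonneg_right (hle n) (sq_nonneg _)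
    _ = _ := by rw [tsum_mul_left, hsu.tsum_eq]; ring

/-- With N = ⌊δa²⌋, at least a quarter of the L² mass of the translate lies in modes n ≥ N, where
the weight is at least (2N+2)^r. -/
theorem exists_le_norm_translate (hr : 0 ≤ s / (2 * (1 - τ))) (u : HSpace τ s) :
    ∃ c > 0, ∀ (a : ℝ) (v : HSpace τ s), v.toL2 = translate a u.toL2 →
      c * japaneseBracket a ^ (s / (2 * (1 - τ))) * ‖u‖ ≤ ‖v‖ := by
  rcases eq_or_ne u 0 with rfl | hu
  · exact ⟨1, one_pos, fun a v _ => by simp⟩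
  have hu0 : 0 < ‖u‖ := norm_pos_iff.2 hu
  have hu2 : 0 < ‖u.toL2‖ := norm_pos_iff.2 fun h => hu (toL2_injective (h.trans (map_zero _).symm))
  obtain ⟨δ, hδ, hlow⟩ := exists_low_modes_bound u.toL2
  -- Both bounds on d are used: d ≤ 1 and d a² ≤ δ a² < N + 1 together give d(1 + a²) ≤ 2N + 2.
  set d := min 1 δ with hd
  have hd0 : 0 < d := lt_min one_pos hδ
  -- The 1/2 is the root of the remaining quarter of the mass; the quotient of norms converts the L²
  -- norm into the norm of ℍ̃^s.
  refine ⟨1 / 2 * d ^ (s / (2 * (1 - τ)) / 2) * ‖u.toL2‖ / ‖u‖, by positivity, fun a v hv => ?_⟩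
  have hsv := hasSum_coeff hv
  set r := s / (2 * (1 - τ)) with hr_def
  apply le_of_sq_le_sq _ (norm_nonneg v)
  have hN : ((⌊δ * a ^ 2⌋₊ : ℕ) : ℝ) ≤ δ * a ^ 2 := Nat.floor_le (by positivity)
  have hN' := Nat.lt_floor_add_one (δ * a ^ 2)
  set N := ⌊δ * a ^ 2⌋₊
  have h1 := (isTranslationSystem_coeff u.toL2).truncatedEnergy_le_tsum
    (monotone_powerWeight hr le_rfl) N a hsv.summable
  rw [hsv.tsum_eq, IsTranslationSystem.truncatedEnergy_eq] at h1
  have h2 : 0 ≤ ∑ n ∈ Finset.range N, powerWeight r 0 n * ‖coeff u.toL2 n a‖ ^ 2 :=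
    Finset.sum_nonneg fun n _ => mul_nonneg (powerWeight_pos _ le_rfl n).le (sq_nonneg _)
  have h3 := hlow a N hN
  have h4 : (d * (1 + a ^ 2)) ^ r ≤ powerWeight r 0 N := by
    unfold powerWeight
    have e1 : d ≤ 1 := min_le_left _ _
    have e2 : d * a ^ 2 ≤ δ * a ^ 2 := by gcongr; exact min_le_right _ _
    have e3 : (0 : ℝ) ≤ N := N.cast_nonneg
    gcongr
    linarith
  have h5 : (1 / 2 * d ^ (r / 2) * ‖u.toL2‖ / ‖u‖ * japaneseBracket a ^ r * ‖u‖) ^ 2 =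
      (d * (1 + a ^ 2)) ^ r * (1 / 4 * ‖u.toL2‖ ^ 2) := by
    have e1 : (d ^ (r / 2)) ^ 2 = d ^ r := by
      rw [← Real.rpow_mul_natCast hd0.le]
      congr 1
      push_cast
      ring
    rw [Real.mul_rpow hd0.le (by positivity), ← japaneseBracket_rpow_sq, ← e1]
    field_simp
    ring
  rw [h5]
  calc (d * (1 + a ^ 2)) ^ r * (1 / 4 * ‖u.toL2‖ ^ 2)
      ≤ powerWeight r 0 N * (‖u.toL2‖ ^ 2 -
          ∑ n ∈ Finset.range N, ‖coeff u.toL2 n a‖ ^ 2) := by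
        refine mul_le_mul h4 ?_ (by positivity) (powerWeight_pos _ le_rfl N).le
        linarith
    _ ≤ _ := by linarith

end HSpace

/-- Coordinatewise convergence and convergence of the weighted norms imply convergence in the
weighted `ℓ²` norm. -/
lemma tendsto_weighted_sub_sq {α : Type*} {l : Filter α} {p : ℕ → ℝ} (hp : ∀ n, 0 ≤ p n)
    {c : α → ℕ → ℂ} {c₀ : ℕ → ℂ} {S D : α → ℝ} {S₀ : ℝ}
    (hS : ∀ a, HasSum (fun n => p n * ‖c a n‖ ^ 2) (S a))
    (hS₀ : HasSum (fun n => p n * ‖c₀ n‖ ^ 2) S₀)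
    (hD : ∀ a, HasSum (fun n => p n * ‖c a n - c₀ n‖ ^ 2) (D a))
    (hc : ∀ n, Tendsto (fun a => c a n) l (𝓝 (c₀ n))) (hSS : Tendsto S l (𝓝 S₀)) :
    Tendsto D l (𝓝 0) := by
  have hD0 : ∀ a, 0 ≤ D a := fun a => (hD a).nonneg fun n => mul_nonneg (hp n) (sq_nonneg _)
  rw [tendsto_order]
  refine ⟨fun b hb => Eventually.of_forall fun a => hb.trans_le (hD0 a), fun η hη => ?_⟩
  obtain ⟨M, hM⟩ := ((tendsto_order.1 hS₀.tendsto_sum_nat).1 (S₀ - η / 4) (by linarith)).exists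
  -- A Fatou argument: F ≥ 0 by |x - y|² ≤ 2|x|² + 2|y|², so dropping its tail bounds D from above.
  -- In the limit this bound is four times the tail of S₀ beyond M, hence less than η.
  set F : α → ℕ → ℝ := fun a n => 2 * (p n * ‖c a n‖ ^ 2) + 2 * (p n * ‖c₀ n‖ ^ 2) -
    p n * ‖c a n - c₀ n‖ ^ 2 with hF
  have hF0 : ∀ a n, 0 ≤ F a n := by
    intro a n
    have h1 := pow_le_pow_left₀ (norm_nonneg _) (norm_sub_le (c a n) (c₀ n)) 2
    have h2 : 0 ≤ 2 * ‖c a n‖ ^ 2 + 2 * ‖c₀ n‖ ^ 2 - ‖c a n - c₀ n‖ ^ 2 := by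
      nlinarith [sq_nonneg (‖c a n‖ - ‖c₀ n‖)]
    have h3 := mul_nonneg (hp n) h2
    simp only [hF]
    linarith
  have hFS : ∀ a, HasSum (F a) (2 * S a + 2 * S₀ - D a) := fun a =>
    (((hS a).mul_left 2).add (hS₀.mul_left 2)).sub (hD a)
  have hle : ∀ a, D a ≤ 2 * S a + 2 * S₀ - ∑ n ∈ Finset.range M, F a n := by
    intro a
    have := sum_le_hasSum (Finset.range M) (fun n _ => hF0 a n) (hFS a)
    linarith
  have hlim : Tendsto (fun a => 2 * S a + 2 * S₀ - ∑ n ∈ Finset.range M, F a n) l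
      (𝓝 (2 * S₀ + 2 * S₀ - ∑ n ∈ Finset.range M, (2 * (p n * ‖c₀ n‖ ^ 2) +
        2 * (p n * ‖c₀ n‖ ^ 2) - p n * ‖c₀ n - c₀ n‖ ^ 2))) := by
    refine ((hSS.const_mul 2).add_const _).sub (tendsto_finsetSum _ fun n _ => ?_)
    exact ((((hc n).norm.pow 2).const_mul _ |>.const_mul 2).add_const _).sub
      ((((hc n).sub_const _).norm.pow 2).const_mul _)
  have hval : 2 * S₀ + 2 * S₀ - ∑ n ∈ Finset.range M, (2 * (p n * ‖c₀ n‖ ^ 2) +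
        2 * (p n * ‖c₀ n‖ ^ 2) - p n * ‖c₀ n - c₀ n‖ ^ 2) < η := by
    have : ∀ n ∈ Finset.range M, 2 * (p n * ‖c₀ n‖ ^ 2) + 2 * (p n * ‖c₀ n‖ ^ 2) -
        p n * ‖c₀ n - c₀ n‖ ^ 2 = 4 * (p n * ‖c₀ n‖ ^ 2) := by
      intro n _
      rw [sub_self, norm_zero]
      ring
    rw [Finset.sum_congr rfl this, ← Finset.mul_sum]
    linarith
  filter_upwards [(tendsto_order.1 hlim).2 η hval] with a ha
  exact (hle a).trans_lt ha

/-- Each coefficient is continuous in a, and the two-sided exponential estimate makes the norm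
continuous; in a weighted ℓ² space these two facts imply strong continuity. -/
theorem HSpace.continuous_of_toL2_eq_translate {τ s : ℝ} (hr : 0 ≤ s / (2 * (1 - τ)))
    {u : HSpace τ s} {V : ℝ → HSpace τ s} (hV : ∀ a, (V a).toL2 = translate a u.toL2) :
    Continuous V := by
  rw [continuous_iff_continuousAt]
  intro b
  have hnorm : Tendsto (fun a => ‖V a‖ ^ 2) (𝓝 b) (𝓝 (‖V b‖ ^ 2)) := by
    set L := 2 * (2 * (s / (2 * (1 - τ))) * Real.exp (s / (2 * (1 - τ))) / Real.sqrt (1 + 0))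
    have hup : ∀ a, ‖V a‖ ^ 2 ≤ Real.exp (L * |a - b|) * ‖V b‖ ^ 2 := fun a =>
      norm_sq_le_exp_mul hr (hV a) (hV b)
    have hlo : ∀ a, Real.exp (-(L * |a - b|)) * ‖V b‖ ^ 2 ≤ ‖V a‖ ^ 2 := by
      intro a
      have h := norm_sq_le_exp_mul hr (hV b) (hV a)
      rw [abs_sub_comm] at h
      calc _ ≤ Real.exp (-(L * |a - b|)) * (Real.exp (L * |a - b|) * ‖V a‖ ^ 2) := by gcongr
        _ = _ := by rw [← mul_assoc, ← Real.exp_add]; simp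
    refine tendsto_of_tendsto_of_tendsto_of_le_of_le ?_ ?_ hlo hup
    · refine ((by fun_prop : Continuous fun a => Real.exp (-(L * |a - b|)) *
        ‖V b‖ ^ 2).tendsto' b _ ?_)
      simp
    · refine ((by fun_prop : Continuous fun a => Real.exp (L * |a - b|) *
        ‖V b‖ ^ 2).tendsto' b _ ?_)
      simp
  have hsub : ∀ a, HasSum (fun n => powerWeight (s / (2 * (1 - τ))) 0 n *
      ‖coeff u.toL2 n a - coeff u.toL2 n b‖ ^ 2) (‖V a - V b‖ ^ 2) := by
    intro a
    have h := (V a - V b).hasSum_norm_sq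
    rw [map_sub, hV, hV] at h
    simpa only [coeff, inner_sub_right] using h
  have h := tendsto_weighted_sub_sq (l := 𝓝 b) (fun n => (powerWeight_pos _ le_rfl n).le)
    (fun a => hasSum_coeff (hV a)) (hasSum_coeff (hV b)) hsub
    (fun n => ((isTranslationSystem_coeff u.toL2).hasDerivAt n b).continuousAt) hnorm
  have h2 := h.sqrt
  simp only [Real.sqrt_sq (norm_nonneg _), Real.sqrt_zero] at h2
  exact tendsto_iff_norm_sub_tendsto_zero.2 h2

/-! ### The transport problem in `ℍ̃^s` -/

lemma IsTransportSolution.toL2_eq {τ s : ℝ} (hr : 0 ≤ s / (2 * (1 - τ))) {ε : ℝ}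
    {u₀ : HSpace τ s} {u : ℝ → HSpace τ s} (h : IsTransportSolution ε u₀ u) (t : ℝ) : (u t).toL2 = translate (ε * t) u₀.toL2 := by
  have hw : IsWeakTransport ε fun t => (u t).toL2 := h.equation
  rw [hw.eq_translate ((HSpace.continuous_toL2 hr).comp h.continuous) t, h.initial]

lemma exists_isTransportSolution {τ s : ℝ} (hr : 0 ≤ s / (2 * (1 - τ)))
    (ε : ℝ) (u₀ : HSpace τ s) :
    ∃ u : ℝ → HSpace τ s, IsTransportSolution ε u₀ u := by
  choose V hV using HSpace.exists_translate hr u₀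
  refine ⟨fun t => V (ε * t), ?_, ?_, ?_⟩
  · exact (HSpace.continuous_of_toL2_eq_translate hr hV).comp (by fun_prop)
  · apply HSpace.toL2_injective
    rw [hV, mul_zero, translate_zero]
  · have h := isWeakTransport_translate ε u₀.toL2
    simp only [← hV] at h
    exact h

theorem transportGloballyWellPosed {τ s : ℝ} (hr : 0 ≤ s / (2 * (1 - τ))) (ε : ℝ) :
    TransportGloballyWellPosed τ s ε := by
  refine ⟨fun u₀ => ?_, fun u₀ T hT η hη => ?_⟩
  · obtain ⟨u, hu⟩ := exists_isTransportSolution hr ε u₀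
    refine ⟨u, hu, fun v hv => funext fun t => HSpace.toL2_injective ?_⟩
    rw [hv.toL2_eq hr, hu.toL2_eq hr]
  · set r := s / (2 * (1 - τ)) with hr_def
    have hb : 0 < japaneseBracket (ε * T) := Real.sqrt_pos.2 (by positivity)
    set A := Real.exp (2 * r * Real.exp r) * japaneseBracket (ε * T) ^ r with hA
    have hA0 : 0 < A := by positivity
    refine ⟨η / A, by positivity, fun v₀ u v hu hv hlt t ht => ?_⟩
    -- By linearity the difference is a translate of the difference of the data, so the growth bound
    -- at time T controls the whole interval.
    have hsub : (v t - u t).toL2 = translate (ε * t) (v₀ - u₀).toL2 := by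
      rw [map_sub, map_sub, map_sub, hv.toL2_eq hr, hu.toL2_eq hr]
    have hbt : japaneseBracket (ε * t) ≤ japaneseBracket (ε * T) := by
      apply Real.sqrt_le_sqrt
      have h1 : t ^ 2 ≤ T ^ 2 := sq_le_sq' ht.1 ht.2
      rw [mul_pow, mul_pow]
      gcongr
    calc ‖v t - u t‖ ≤ Real.exp (2 * r * Real.exp r) * japaneseBracket (ε * t) ^ r * ‖v₀ - u₀‖ :=
          HSpace.norm_translate_le hr hsub
      _ ≤ A * ‖v₀ - u₀‖ := by
          rw [hA]
          have : 0 ≤ japaneseBracket (ε * t) := Real.sqrt_nonneg _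
          gcongr
      _ < A * (η / A) := by gcongr
      _ = η := by field_simp

end HarmonicSobolev

theorem propositionA2 (τ s : ℝ) (hτ0 : 0 ≤ τ) (hτ1 : τ < 1) (hs : 0 ≤ s) :
    (∀ ε : ℝ, 0 < ε →
      HarmonicSobolev.TransportGloballyWellPosed τ s ε ∧
      ∀ (u₀ : HarmonicSobolev.HSpace τ s) (u : ℝ → HarmonicSobolev.HSpace τ s),
        HarmonicSobolev.IsTransportSolution ε u₀ u →
          ∀ t : ℝ, ∀ᵐ x : ℝ, (u t).toL2 x = u₀.toL2 (x - ε * t)) ∧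
    (∃ C : ℝ, 0 < C ∧
      ∀ u₀ : HarmonicSobolev.HSpace τ s, ∃ c : ℝ, 0 < c ∧
        ∀ ε : ℝ, 0 < ε → ∀ u : ℝ → HarmonicSobolev.HSpace τ s,
          HarmonicSobolev.IsTransportSolution ε u₀ u → ∀ t : ℝ,
            c * HarmonicSobolev.japaneseBracket (ε * t) ^ (s / (2 * (1 - τ))) * ‖u₀‖ ≤ ‖u t‖ ∧
            ‖u t‖ ≤
              C * HarmonicSobolev.japaneseBracket (ε * t) ^ (s / (2 * (1 - τ))) * ‖u₀‖) := by
  have hr : 0 ≤ s / (2 * (1 - τ)) := div_nonneg hs (by linarith)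
  refine ⟨fun ε _ => ⟨HarmonicSobolev.transportGloballyWellPosed hr ε, fun u₀ u hu t => ?_⟩, ?_⟩
  · rw [hu.toL2_eq hr t]
    exact HarmonicSobolev.coeFn_translate (ε * t) u₀.toL2
  · refine ⟨Real.exp (2 * (s / (2 * (1 - τ))) * Real.exp (s / (2 * (1 - τ)))), Real.exp_pos _,
      fun u₀ => ?_⟩
    -- The lower bound holds for every shift a, so c is fixed before ε and t enter through a = εt.
    obtain ⟨c, hc, h⟩ := HarmonicSobolev.HSpace.exists_le_norm_translate hr u₀
    exact ⟨c, hc, fun ε _ u hu t => ⟨h _ _ (hu.toL2_eq hr t),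
      HarmonicSobolev.HSpace.norm_translate_le hr (hu.toL2_eq hr t)⟩⟩
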